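/- **Setting.** Let $n\ge 2$, $p>\lfloor n/2\rfloor$, $a>0$, let $\Omega\subseteq\mathbb R^n$ be a bounded domain, and let $\varphi$ be a positive convex function on $(0,\infty)$ with $\lim_{t\to0^+}\varphi(t)=\infty$ and $\lim_{t\to\infty}\varphi(t)/t=\infty$, extended by $\varphi(t)=\infty$ for $t\le 0$. For $f\in W^{1,p}(\Omega,\mathbb R^n)$ put $$E(f)=\int_\Omega\bigl(|Df|^p+\varphi(J_f)\bigr)\,dx,\qquad J_f=\det Df .$$ A map $f$ satisfies the Lusin $(N)$ condition if $|f(S)|=0$ for every $S\subseteq\Omega$ with $|S|=0$. Let $f_0\in W^{1,p}(\Omega,\mathbb R^n)$ be a homeomorphism from $\overline\Omega$ onto its image in $\mathbb R^n$ that satisfies the Lusin $(N)$ condition, with $E(f_0)<\infty$ and $|f_0(\partial\Omega)|=0$. Let $\mathcal K$ be the family of connected compact sets $K\subseteq f_0(\Omega)$ with $|K|>0$ and $\mathcal H^{n-1}(\partial K)<\infty$. Let $\mathcal H_{c,f_0}^{1,p}$ be the class of all $f\in W^{1,p}(\Omega,\mathbb R^n)$ that satisfy the Lusin $(N)$ condition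 and $f=f_0$ on $\partial\Omega$, and for which there are finitely many points $x_1,\dots,x_m\in\Omega$ and pairwise disjoint $K_1,\dots,K_m\in\mathcal K$ ($m\ge 0$) such that $f$ is a homeomorphism of $\overline\Omega\setminus\{x_1,\dots,x_m\}$ onto $\overline{f_0(\Omega)}\setminus(K_1\cup\dots\cup K_m)$. For such $f$ the cavity set is $A(f)=K_1\cup\dots\cup K_m$, and $E_c(f)=E(f)+a\,P(A(f),\mathbb R^n)$, where $P$ denotes the perimeter. For measurable sets, $A_k\to A$ means $|A_k\triangle A|\to0$. Let $C\in\mathbb R$. **Theorem 4.2.** (i) Let $f_k\in\mathcal H_{c,f_0}^{1,p}$ satisfy $E_c(f_k)\le C$ for all $k$, $f_k\rightharpoonup f$ weakly in $W^{1,p}(\Omega,\mathbb R^n)$ and $f_k\to f$ a.e. in $\Omega$. If two subsequences satisfy $A(f_{k_\ell})\to A^1$ and $A(f_{k_m})\to A^2$, where $A^1,A^2$ are measurable, then $|A^1\triangle A^2|=0$. (ii) Consequently the cavity set of a limit map is well defined: if $f$ is the weak limit in $W^{1,p}(\Omega,\mathbb R^n)$ of some sequence in $\mathcal H_{c,f_0}^{1,p}$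 with $E_c\le C$, then there is a measurable set $A(f)$, unique up to a null set, such that $A(f_k)\to A(f)$ for every sequence $f_k\in\mathcal H_{c,f_0}^{1,p}$ with $E_c(f_k)\le C$ and $f_k\rightharpoonup f$ weakly in $W^{1,p}(\Omega,\mathbb R^n)$. -/

import Mathlib

open MeasureTheory Filter Topology Set
open scoped ENNReal ContDiff symmDiff

namespace Cavitation

noncomputable section

/-- Euclidean `n`-space. -/
abbrev Space (n : ℕ) := EuclideanSpace ℝ (Fin n)

/-! ### Sobolev maps -/

/-- `G` is the weak derivative of the locally integrable map `f` in the open set `Ω`: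
for every scalar test function `ψ ∈ C_c^∞(Ω)` and every direction `v`,
`∫_Ω (∂_v ψ) f = - ∫_Ω ψ (G v)`. -/
structure HasWeakDeriv {n : ℕ} (Ω : Set (Space n)) (f : Space n → Space n)
    (G : Space n → (Space n →L[ℝ] Space n)) : Prop where
  locInt : LocallyIntegrableOn f Ω volume
  locInt_deriv : LocallyIntegrableOn G Ω volume
  integral_eq : ∀ ψ : Space n → ℝ, ContDiff ℝ ∞ ψ → HasCompactSupport ψ → tsupport ψ ⊆ Ω →
    ∀ v : Space n, ∫ x in Ω, (fderiv ℝ ψ x v) • f x = - ∫ x in Ω, ψ x • G x v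

open Classical in
/-- The weak derivative `Df` of `f` in `Ω` (unique up to null sets; `0` if there is none). -/
def weakDeriv {n : ℕ} (Ω : Set (Space n)) (f : Space n → Space n) :
    Space n → (Space n →L[ℝ] Space n) :=
  if h : ∃ G, HasWeakDeriv Ω f G then h.choose else 0

/-- `f ∈ W^{1,p}(Ω, ℝⁿ)`: `f ∈ L^p(Ω)`, and `f` has a weak derivative in `L^p(Ω)`. -/
def MemSobolev {n : ℕ} (Ω : Set (Space n)) (p : ℝ) (f : Space n → Space n) : Prop :=
  MemLp f (ENNReal.ofReal p) (volume.restrict Ω) ∧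
    ∃ G, HasWeakDeriv Ω f G ∧ MemLp G (ENNReal.ofReal p) (volume.restrict Ω)

/-- `f_k ⇀ f` weakly in `W^{1,p}(Ω, ℝⁿ)`, where `1 < p < ∞`: all maps lie in `W^{1,p}`, and
`f_k ⇀ f`, `Df_k ⇀ Df` weakly in `L^p(Ω)`, i.e. when tested with the functions of `L^q(Ω)`,
`1/p + 1/q = 1` (the integrals are vector- and matrix-valued, so this is componentwise weak
convergence). -/
structure WeakConv {n : ℕ} (Ω : Set (Space n)) (p : ℝ) (fk : ℕ → Space n → Space n)
    (f : Space n → Space n) : Prop where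
  mem : ∀ k, MemSobolev Ω p (fk k)
  mem_lim : MemSobolev Ω p f
  tendsto : ∀ q : ℝ, p.HolderConjugate q → ∀ g : Space n → ℝ,
    MemLp g (ENNReal.ofReal q) (volume.restrict Ω) →
      Tendsto (fun k => ∫ x in Ω, g x • fk k x) atTop (𝓝 (∫ x in Ω, g x • f x))
  tendsto_deriv : ∀ q : ℝ, p.HolderConjugate q → ∀ g : Space n → ℝ,
    MemLp g (ENNReal.ofReal q) (volume.restrict Ω) →
      Tendsto (fun k => ∫ x in Ω, g x • weakDeriv Ω (fk k) x) atTop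
        (𝓝 (∫ x in Ω, g x • weakDeriv Ω f x))

/-! ### Energies -/

/-- The growth assumptions on `φ`: it is positive and convex on `(0, ∞)`, tends to `∞` at `0⁺`,
and is superlinear at `∞`. -/
structure GrowthAssumptions (φ : ℝ → ℝ) : Prop where
  pos : ∀ t, 0 < t → 0 < φ t
  convex : ConvexOn ℝ (Ioi 0) φ
  tendsto_zero : Tendsto φ (𝓝[>] 0) atTop
  tendsto_top : Tendsto (fun t => φ t / t) atTop atTop

/-- `φ` is given on `(0, ∞)` and is extended by `∞` to `(-∞, 0]`. -/
def extend (φ : ℝ → ℝ) (t : ℝ) : ℝ≥0∞ := if 0 < t then ENNReal.ofReal (φ t) else ⊤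

/-- The energy `E(f) = ∫_Ω |Df|^p + φ(J_f)`, with values in `[0, ∞]`, where `J_f = det Df`. -/
def energy {n : ℕ} (Ω : Set (Space n)) (p : ℝ) (φ : ℝ → ℝ) (f : Space n → Space n) : ℝ≥0∞ :=
  ∫⁻ x in Ω, (‖weakDeriv Ω f x‖ₑ ^ p + extend φ (weakDeriv Ω f x).det)

/-- The divergence of a vector field. -/
def divergence {n : ℕ} (ψ : Space n → Space n) (x : Space n) : ℝ :=
  ∑ i, fderiv ℝ ψ x (EuclideanSpace.single i 1) i

/-- The perimeter of `A` in `ℝⁿ`: the supremum of `∫_A div ψ` over the `C¹` vector fields `ψ` of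
compact support with `|ψ| ≤ 1`. -/
def perimeter {n : ℕ} (A : Set (Space n)) : ℝ≥0∞ :=
  ⨆ (ψ : Space n → Space n) (_ : ContDiff ℝ 1 ψ) (_ : HasCompactSupport ψ)
    (_ : ∀ x, ‖ψ x‖ ≤ 1), ENNReal.ofReal (∫ x in A, divergence ψ x)

/-- The energy `E_c(f) = E(f) + a P(A(f), ℝⁿ)` of a map `f` with cavity set `A(f) = A`. -/
def cavityEnergy {n : ℕ} (Ω : Set (Space n)) (p : ℝ) (φ : ℝ → ℝ) (a : ℝ)
    (f : Space n → Space n) (A : Set (Space n)) : ℝ≥0∞ :=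
  energy Ω p φ f + ENNReal.ofReal a * perimeter A

/-! ### Homeomorphisms with finitely many cavities -/

/-- The Lusin `(N)` condition on `Ω`. -/
def LusinN {n : ℕ} (Ω : Set (Space n)) (f : Space n → Space n) : Prop :=
  ∀ S ⊆ Ω, volume S = 0 → volume (f '' S) = 0

/-- `𝒦(U)`: the connected compact subsets of `U` of positive measure whose boundary has finite
`(n-1)`-dimensional Hausdorff measure. -/
def admissibleCavities {n : ℕ} (U : Set (Space n)) : Set (Set (Space n)) :=
  {K | K ⊆ U ∧ IsConnected K ∧ IsCompact K ∧ 0 < volume K ∧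
    Measure.hausdorffMeasure ((n : ℝ) - 1) (frontier K) < ⊤}

/-- `f` belongs to `𝓗_{c,f₀}^{1,p}` and `A(f) = A`: there are points `x₁, …, x_m ∈ Ω` and disjoint
`K₁, …, K_m ∈ 𝒦(f₀(Ω))` such that `f` is a homeomorphism of `Ω̄ ∖ {x₁, …, x_m}` onto
`\overline{f₀(Ω)} ∖ (K₁ ∪ … ∪ K_m)`, and `A = K₁ ∪ … ∪ K_m`; moreover `f ∈ W^{1,p}(Ω, ℝⁿ)`,
`f = f₀` on `∂Ω`, and `f` satisfies the Lusin `(N)` condition. -/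
structure HasCavitySet {n : ℕ} (Ω : Set (Space n)) (p : ℝ) (f₀ f : Space n → Space n)
    (A : Set (Space n)) : Prop where
  mem_sobolev : MemSobolev Ω p f
  exists_cavities : ∃ (m : ℕ) (x : Fin m → Space n) (K : Fin m → Set (Space n)),
    (∀ i, x i ∈ Ω) ∧ (∀ i, K i ∈ admissibleCavities (f₀ '' Ω)) ∧
    Pairwise (fun i j => Disjoint (K i) (K j)) ∧
    IsEmbedding ((closure Ω \ range x).domRestrict f) ∧
    f '' (closure Ω \ range x) = closure (f₀ '' Ω) \ ⋃ i, K i ∧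
    A = ⋃ i, K i
  eqOn_frontier : EqOn f f₀ (frontier Ω)
  lusin : LusinN Ω f

/-- `f_k ∈ 𝓗_{c,f₀}^{1,p}` with cavity sets `A(f_k) = A_k`, `E_c(f_k) ≤ C` for all `k`, and
`f_k ⇀ f` weakly in `W^{1,p}(Ω, ℝⁿ)`. -/
structure IsApproximation {n : ℕ} (Ω : Set (Space n)) (p : ℝ) (φ : ℝ → ℝ) (a : ℝ)
    (f₀ : Space n → Space n) (C : ℝ) (fk : ℕ → Space n → Space n) (Ak : ℕ → Set (Space n))
    (f : Space n → Space n) : Prop where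
  hasCavitySet : ∀ k, HasCavitySet Ω p f₀ (fk k) (Ak k)
  energy_le : ∀ k, cavityEnergy Ω p φ a (fk k) (Ak k) ≤ ENNReal.ofReal C
  weakConv : WeakConv Ω p fk f

/-- The class of weak limits of sequences of `𝓗_{c,f₀}^{1,p}` with `E_c ≤ C`. -/
def weakClosure {n : ℕ} (Ω : Set (Space n)) (p : ℝ) (φ : ℝ → ℝ) (a : ℝ)
    (f₀ : Space n → Space n) (C : ℝ) : Set (Space n → Space n) :=
  {f | ∃ fk Ak, IsApproximation Ω p φ a f₀ C fk Ak f}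

/-- Convergence of sets in measure: `|A_k △ A| → 0`. -/
def TendstoInMeas {n : ℕ} (Ak : ℕ → Set (Space n)) (A : Set (Space n)) : Prop :=
  Tendsto (fun k => volume (Ak k ∆ A)) atTop (𝓝 0)

/-- `A` is a cavity set `A(f)` of the limit map `f`: it is the limit in measure of the cavity sets
`A(f_k)` for every sequence `f_k` in `𝓗_{c,f₀}^{1,p}` with `E_c(f_k) ≤ C` and `f_k ⇀ f`. -/
def IsLimitCavitySet {n : ℕ} (Ω : Set (Space n)) (p : ℝ) (φ : ℝ → ℝ) (a : ℝ)
    (f₀ : Space n → Space n) (C : ℝ) (f : Space n → Space n) (A : Set (Space n)) : Prop :=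
  NullMeasurableSet A volume ∧
    ∀ fk Ak, IsApproximation Ω p φ a f₀ C fk Ak f → TendstoInMeas Ak A

end

end Cavitation

open Cavitation

/-!
Let `D` be the closure of `f₀(Ω)`. The area formula says that `f_k` pushes the measure
`|J_{f_k}| dx` on `Ω` forward to Lebesgue measure on `D ∖ A(f_k)`. The bound on `∫ φ(J_{f_k})` makes
`|J_{f_k}| dx` and `dx` absolutely continuous with respect to each other uniformly in `k`: one way
because `φ(t) → ∞` as `t → 0⁺`, the other way because `φ` is superlinear. By Rellich's theorem a
subsequence of `f_k` converges a.e., and in the limit the push-forward of `dx` on `Ω` under `f` has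
the same null sets as Lebesgue measure on `D ∖ A`, for every limit `A` of `A(f_k)`. Hence `f`
determines `A` up to a null set. The perimeter bound makes the cavity sets precompact with respect
to convergence in measure, so that the uniqueness of the limit gives convergence of the whole
sequence.
-/

namespace Cavitation

open scoped Convolution

/-! ### Dyadic mollification -/

lemma half_pow_le_half_pow {i j : ℕ} (h : j ≤ i) : ((1 : ℝ) / 2) ^ i ≤ (1 / 2) ^ j :=
  pow_le_pow_of_le_one (by norm_num) (by norm_num) h

lemma tendsto_half_pow : Tendsto (fun j : ℕ => ((1 : ℝ) / 2) ^ j) atTop (𝓝 0) :=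
  tendsto_pow_atTop_nhds_zero_of_lt_one (by norm_num) (by norm_num)

section MeanDeviation

variable {V : Type*} [NormedAddCommGroup V] [InnerProductSpace ℝ V] [FiniteDimensional ℝ V]
  [MeasurableSpace V] [BorelSpace V] {E : Type*} [NormedAddCommGroup E]

/-- The mean distance of `g` to the value `c` over the ball of radius `2 · 2^{-j}` about `x`; it
controls at `x` the mollifications of `g` at the scales `2^{-j}` and `2^{-j-1}`. -/
noncomputable def meanDeviation (g : V → E) (j : ℕ) (x : V) (c : E) : ℝ :=
  ⨍ t in Metric.closedBall x (2 * (1 / 2) ^ j), ‖g t - c‖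

lemma ae_tendsto_meanDeviation {g : V → E} (hg : LocallyIntegrable g) :
    ∀ᵐ x, Tendsto (fun j => meanDeviation g j x (g x)) atTop (𝓝 0) := by
  filter_upwards [IsUnifLocDoublingMeasure.ae_tendsto_average_norm_sub volume hg 1] with x hx
  refine hx (fun _ => x) (fun j => 2 * (1 / 2) ^ j) (tendsto_nhdsWithin_iff.2
    ⟨by simpa using tendsto_half_pow.const_mul 2, .of_forall fun j => mem_Ioi.2 (by positivity)⟩)
    (.of_forall fun j => Metric.mem_closedBall_self (by positivity))

end MeanDeviation

section Mollify

variable {V : Type*} [NormedAddCommGroup V] [InnerProductSpace ℝ V] [FiniteDimensional ℝ V]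
  [MeasurableSpace V] [BorelSpace V] {E : Type*} [NormedAddCommGroup E] [NormedSpace ℝ E]

variable (V) in
/-- The smooth bump function on the ball of radius `2^{-j}` about `0`, equal to `1` on the ball of
half that radius. -/
noncomputable def dyadicBump (j : ℕ) : ContDiffBump (0 : V) where
  rIn := (1 / 2) ^ j / 2
  rOut := (1 / 2) ^ j
  rIn_pos := by positivity
  rIn_lt_rOut := half_lt_self (by positivity)

variable (V) in
/-- The standard mollifier at the dyadic scale `2^{-j}`. -/
noncomputable def mollifier (j : ℕ) : V → ℝ := (dyadicBump V j).normed volume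

/-- The mollification of `g` at the dyadic scale `2^{-j}`. -/
noncomputable def mollify (j : ℕ) (g : V → E) : V → E :=
  mollifier V j ⋆[ContinuousLinearMap.lsmul ℝ ℝ, volume] g

lemma contDiff_mollifier (j : ℕ) : ContDiff ℝ ∞ (mollifier V j) :=
  (dyadicBump V j).contDiff_normed

lemma continuous_mollifier (j : ℕ) : Continuous (mollifier V j) :=
  (dyadicBump V j).continuous_normed

lemma hasCompactSupport_mollifier (j : ℕ) : HasCompactSupport (mollifier V j) :=
  (dyadicBump V j).hasCompactSupport_normed

lemma mollifier_nonneg (j : ℕ) (x : V) : 0 ≤ mollifier V j x :=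
  (dyadicBump V j).nonneg_normed x

lemma integral_mollifier (j : ℕ) : ∫ x, mollifier V j x = 1 :=
  (dyadicBump V j).integral_normed

lemma support_mollifier (j : ℕ) :
    Function.support (mollifier V j) = Metric.ball 0 ((1 / 2) ^ j) :=
  (dyadicBump V j).support_normed_eq

lemma mollifier_sub_eq_zero {j : ℕ} {x t : V} (h : (1 / 2) ^ j ≤ dist x t) :
    mollifier V j (x - t) = 0 := by
  rwa [← Function.notMem_support, support_mollifier, mem_ball_zero_iff, ← dist_eq_norm, not_lt]

lemma mollifier_neg (j : ℕ) (x : V) : mollifier V j (-x) = mollifier V j x :=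
  (dyadicBump V j).normed_neg x

lemma mollifier_le {i j : ℕ} (h : i ≤ j + 1) (x y : V) :
    mollifier V i x ≤ 8 ^ Module.finrank ℝ V /
      volume.real (Metric.closedBall y (2 * (1 / 2) ^ j)) := by
  have hpos : 0 < volume.real (Metric.ball (0 : V) 1) :=
    ENNReal.toReal_pos (Metric.measure_ball_pos volume _ one_pos).ne' measure_ball_lt_top.ne
  have hle : (2 * (1 / 2) ^ j : ℝ) ≤ 8 * ((1 / 2) ^ i / 2) := by
    have := half_pow_le_half_pow h
    rw [pow_succ] at this
    linarith
  refine ((dyadicBump V i).normed_le_div_measure_closedBall_rIn volume x).trans ?_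
  rw [Measure.addHaar_real_closedBall _ _ (dyadicBump V i).rIn_pos.le,
    Measure.addHaar_real_closedBall _ _ (by positivity), div_le_div_iff₀ (by
      have := (dyadicBump V i).rIn_pos
      positivity) (by positivity), one_mul, ← mul_assoc, ← mul_pow]
  exact mul_le_mul_of_nonneg_right (pow_le_pow_left₀ (by positivity) hle _) hpos.le

lemma mollify_apply (j : ℕ) (g : V → E) (x : V) :
    mollify j g x = ∫ t, mollifier V j (x - t) • g t :=
  convolution_lsmul_swap

lemma mollify_indicator {s : Set V} (hs : MeasurableSet s) (j : ℕ) (g : V → E) (x : V) :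
    mollify j (s.indicator g) x = ∫ t in s, mollifier V j (x - t) • g t := by
  rw [mollify_apply, ← integral_indicator hs]
  congr with t
  by_cases ht : t ∈ s <;> simp [ht]

lemma hasCompactSupport_mollifier_sub (j : ℕ) (x : V) :
    HasCompactSupport fun t => mollifier V j (x - t) :=
  (hasCompactSupport_mollifier j).comp_homeomorph (Homeomorph.subLeft x)

lemma memLp_mollifier_sub (j : ℕ) (x : V) (q : ℝ≥0∞) :
    MemLp (fun t => mollifier V j (x - t)) q :=
  ((continuous_mollifier j).comp (continuous_const.sub continuous_id)
    ).memLp_of_hasCompactSupport (hasCompactSupport_mollifier_sub j x)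

lemma integrable_mollifier_sub_smul (j : ℕ) {g : V → E} (hg : LocallyIntegrable g) (x : V) :
    Integrable fun t => mollifier V j (x - t) • g t :=
  hg.integrable_smul_left_of_hasCompactSupport
    ((continuous_mollifier j).comp (continuous_const.sub continuous_id))
    (hasCompactSupport_mollifier_sub j x)

lemma integral_mollifier_sub (j : ℕ) (x : V) : ∫ t, mollifier V j (x - t) = 1 := by
  rw [integral_sub_left_eq_self (mollifier V j), integral_mollifier]

lemma continuous_mollify (j : ℕ) {g : V → E} (hg : LocallyIntegrable g) :
    Continuous (mollify j g) :=
  (hasCompactSupport_mollifier j).continuous_convolution_left _ (continuous_mollifier j) hg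

lemma mollify_sub (j : ℕ) {g h : V → E} (hg : LocallyIntegrable g) (hh : LocallyIntegrable h)
    (x : V) : mollify j (fun y => g y - h y) x = mollify j g x - mollify j h x := by
  simp only [mollify_apply, smul_sub]
  exact integral_sub (integrable_mollifier_sub_smul j hg x) (integrable_mollifier_sub_smul j hh x)

lemma mollify_const [CompleteSpace E] (j : ℕ) (c : E) (x : V) : mollify j (fun _ => c) x = c := by
  rw [mollify_apply, integral_smul_const, integral_mollifier_sub, one_smul]

lemma norm_mollify_sub_le [CompleteSpace E] {g : V → E} (hg : LocallyIntegrable g) {i j : ℕ}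
    (hij : i ≤ j + 1) {x y : V} (hy : dist y x + (1 / 2) ^ i ≤ 2 * (1 / 2) ^ j) (c : E) :
    ‖mollify i g y - c‖ ≤ 8 ^ Module.finrank ℝ V * meanDeviation g j x c := by
  set B := Metric.closedBall x (2 * (1 / 2) ^ j)
  set b := (8 : ℝ) ^ Module.finrank ℝ V / volume.real B
  have hB : MeasurableSet B := Metric.isClosed_closedBall.measurableSet
  have hdev : LocallyIntegrable fun t => g t - c := hg.sub (locallyIntegrable_const c)
  have hmean : 8 ^ Module.finrank ℝ V * meanDeviation g j x c
      = ∫ t, B.indicator (fun t => b * ‖g t - c‖) t := by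
    rw [integral_indicator hB, integral_const_mul, meanDeviation, setAverage_eq, smul_eq_mul]
    ring
  have hmol : mollify i g y - c = ∫ t, mollifier V i (y - t) • (g t - c) := by
    rw [← mollify_apply, mollify_sub i hg (locallyIntegrable_const c), mollify_const]
  rw [hmean, hmol]
  refine norm_integral_le_of_norm_le ((integrable_indicator_iff hB).2
    ((hdev.integrableOn_isCompact (isCompact_closedBall x _)).norm.const_mul b))
    (.of_forall fun t => ?_)
  rw [norm_smul, Real.norm_of_nonneg (mollifier_nonneg _ _)]
  by_cases ht : t ∈ B
  · rw [indicator_of_mem ht]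
    gcongr
    exact mollifier_le hij _ _
  · have hty : (1 / 2) ^ i ≤ dist y t := by
      have := dist_triangle_left t x y
      linarith [not_le.1 (mt Metric.mem_closedBall.2 ht)]
    rw [mollifier_sub_eq_zero hty, zero_mul, indicator_of_notMem ht]

lemma ae_tendsto_mollify [CompleteSpace E] {g : V → E} (hg : LocallyIntegrable g) :
    ∀ᵐ x, Tendsto (fun j => mollify j g x) atTop (𝓝 (g x)) := by
  refine ContDiffBump.ae_convolution_tendsto_right_of_locallyIntegrable (φ := dyadicBump V)
    (K := 2) tendsto_half_pow (.of_forall fun j => ?_) hg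
  simp only [dyadicBump]
  linarith

lemma mollify_mollify [CompleteSpace E] (i j : ℕ) {g : V → E} (hg : LocallyIntegrable g) :
    mollify i (mollify j g) = (mollifier V i ⋆[ContinuousLinearMap.lsmul ℝ ℝ, volume]
      mollifier V j) ⋆[ContinuousLinearMap.lsmul ℝ ℝ, volume] g := by
  have hgn : LocallyIntegrable fun x => ‖g x‖ := fun x => (hg x).norm
  have hjg : Continuous ((fun x => ‖mollifier V j x‖) ⋆[ContinuousLinearMap.mul ℝ ℝ, volume]
      fun x => ‖g x‖) :=
    (hasCompactSupport_mollifier j).norm.continuous_convolution_left _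
      (continuous_mollifier j).norm hgn
  ext x
  refine (convolution_assoc _ _ _ _ (fun a b c => ?_)
    (continuous_mollifier i).aestronglyMeasurable (continuous_mollifier j).aestronglyMeasurable
    hg.aestronglyMeasurable (.of_forall fun y => ?_) (.of_forall fun y => ?_) ?_).symm
  · simpa [mul_smul] using smul_comm a b c
  · exact (hasCompactSupport_mollifier i).convolutionExists_left _ (continuous_mollifier i)
      (continuous_mollifier j).locallyIntegrable y
  · exact (hasCompactSupport_mollifier j).norm.convolutionExists_left _
      (continuous_mollifier j).norm hgn y
  · exact (hasCompactSupport_mollifier i).norm.convolutionExists_left _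
      (continuous_mollifier i).norm (hjg.locallyIntegrable (μ := volume)) x

lemma mollify_comm [CompleteSpace E] (i j : ℕ) {g : V → E} (hg : LocallyIntegrable g) :
    mollify i (mollify j g) = mollify j (mollify i g) := by
  rw [mollify_mollify i j hg, mollify_mollify j i hg]
  congr 1
  rw [← convolution_flip]
  congr 1
  ext
  simp

lemma mollify_clm_sub (j : ℕ) (L : V →L[ℝ] E) (x : V) :
    mollify j (fun y => L (y - x)) x = 0 := by
  have hmol : mollify j (fun y => L (y - x)) x = ∫ t, mollifier V j t • L (-t) := by
    simp [mollify, convolution_def]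
  have hodd : ∫ t, mollifier V j t • L (-t) = -∫ t, mollifier V j t • L (-t) := by
    conv_lhs => rw [← integral_neg_eq_self]
    simp only [← integral_neg, mollifier_neg, map_neg, smul_neg]
  rw [hmol]
  have : IsAddTorsionFree E := .of_isTorsionFree ℝ E
  exact self_eq_neg.1 hodd

end Mollify

/-! ### Weak derivatives and mollification -/

section MollifiedFDeriv

variable {V : Type*} [NormedAddCommGroup V] [InnerProductSpace ℝ V] [FiniteDimensional ℝ V]
  [MeasurableSpace V] [BorelSpace V] {E : Type*} [NormedAddCommGroup E] [NormedSpace ℝ E]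
  {Ω : Set V} {f : V → E} {G : V → V →L[ℝ] E}

/-- The derivatives in `Ω` of the mollifications of `f` are the mollifications of `G`: the form in
which a weak derivative `G` of `f` is used. Both functions are defined on the whole space, and only
points at distance at least `2^{-j}` from the complement of `Ω` matter at the scale `2^{-j}`. -/
structure HasMollifiedFDeriv (Ω : Set V) (f : V → E) (G : V → V →L[ℝ] E) : Prop where
  locInt : LocallyIntegrable f
  locInt_deriv : LocallyIntegrable G
  hasFDerivAt : ∀ j x, Metric.closedBall x ((1 / 2) ^ j) ⊆ Ω →
    HasFDerivAt (mollify j f) (mollify j G x) x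

namespace HasMollifiedFDeriv

lemma norm_mollify_image_sub_le [CompleteSpace E] (h : HasMollifiedFDeriv Ω f G) {i j : ℕ}
    (hji : j ≤ i) (hij : i ≤ j + 1) {x y : V} (hx : Metric.closedBall x (2 * (1 / 2) ^ j) ⊆ Ω)
    (hy : dist y x ≤ (1 / 2) ^ j) (L : V →L[ℝ] E) :
    ‖mollify i f y - mollify i f x - L (y - x)‖
      ≤ 8 ^ Module.finrank ℝ V * meanDeviation G j x L * ‖y - x‖ := by
  have hi := half_pow_le_half_pow hji
  have hball : ∀ z ∈ Metric.closedBall x ((1 / 2) ^ j),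
      dist z x + (1 / 2) ^ i ≤ 2 * (1 / 2) ^ j := fun z hz => by
    linarith [Metric.mem_closedBall.1 hz]
  refine Convex.norm_image_sub_le_of_norm_hasFDerivWithin_le' (f' := mollify i G)
    (fun z hz => (h.hasFDerivAt i z ?_).hasFDerivWithinAt)
    (fun z hz => norm_mollify_sub_le h.locInt_deriv hij (hball z hz) L)
    (convex_closedBall x ((1 / 2) ^ j)) (Metric.mem_closedBall_self (by positivity)) hy
  refine (Metric.closedBall_subset_closedBall' ?_).trans hx
  linarith [hball z hz]

lemma norm_mollify_mollify_sub_le [CompleteSpace E] (h : HasMollifiedFDeriv Ω f G) {i i' j : ℕ}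
    (hji : j ≤ i) (hij : i ≤ j + 1) (hji' : j ≤ i') {x : V}
    (hx : Metric.closedBall x (2 * (1 / 2) ^ j) ⊆ Ω) (L : V →L[ℝ] E) :
    ‖mollify i' (mollify i f) x - mollify i f x‖
      ≤ 8 ^ Module.finrank ℝ V * meanDeviation G j x L * (1 / 2) ^ j := by
  have hf : Continuous (mollify i f) := continuous_mollify i h.locInt
  have hL : Continuous fun y => L (y - x) := by fun_prop
  have hmol : mollify i' (mollify i f) x
      = mollify i' (fun y => mollify i f y - L (y - x)) x := by
    rw [mollify_sub i' hf.locallyIntegrable hL.locallyIntegrable, mollify_clm_sub, sub_zero]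
  rw [hmol, ← dist_eq_norm]
  refine dist_convolution_le (R := (1 / 2) ^ i')
    (mul_nonneg (mul_nonneg (by positivity) (integral_nonneg fun _ => norm_nonneg _))
      (by positivity))
    (support_mollifier i').subset (mollifier_nonneg i') (integral_mollifier i')
    (hf.sub hL).aestronglyMeasurable fun y hy => ?_
  have hyx : dist y x ≤ (1 / 2) ^ j := (Metric.mem_ball.1 hy).le.trans (half_pow_le_half_pow hji')
  rw [dist_eq_norm, sub_right_comm]
  refine (h.norm_mollify_image_sub_le hji hij hx hyx L).trans ?_
  rw [← dist_eq_norm]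
  exact mul_le_mul_of_nonneg_left hyx
    (mul_nonneg (by positivity) (integral_nonneg fun _ => norm_nonneg _))

/-- Both `mollify j f` and `mollify (j + 1) f` are compared with `f` mollified twice, at both
scales, using that mollifications commute. -/
lemma dist_mollify_succ_le [CompleteSpace E] (h : HasMollifiedFDeriv Ω f G) {j : ℕ} {x : V}
    (hx : Metric.closedBall x (2 * (1 / 2) ^ j) ⊆ Ω) (L : V →L[ℝ] E) :
    dist (mollify j f x) (mollify (j + 1) f x)
      ≤ 2 * (8 ^ Module.finrank ℝ V * meanDeviation G j x L) * (1 / 2) ^ j := by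
  have hcoarse := h.norm_mollify_mollify_sub_le le_rfl (Nat.le_succ j) (Nat.le_succ j) hx L
  have hfine := h.norm_mollify_mollify_sub_le (Nat.le_succ j) le_rfl le_rfl hx L
  rw [mollify_comm (j + 1) j h.locInt, ← dist_eq_norm, dist_comm] at hcoarse
  rw [← dist_eq_norm] at hfine
  linarith [dist_triangle (mollify j f x) (mollify j (mollify (j + 1) f) x)
    (mollify (j + 1) f x)]

end HasMollifiedFDeriv

end MollifiedFDeriv

section WeakDeriv

variable {n : ℕ} {Ω : Set (Space n)} {f : Space n → Space n} {p : ℝ}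
  {G G' : Space n → (Space n →L[ℝ] Space n)}

lemma locallyIntegrable_indicator {X E : Type*} [TopologicalSpace X] [MeasurableSpace X]
    [NormedAddCommGroup E] {μ : Measure X} {s : Set X} (hs : MeasurableSet s) {g : X → E}
    (hg : IntegrableOn g s μ) : LocallyIntegrable (s.indicator g) μ :=
  (hg.integrable_indicator hs).locallyIntegrable

lemma fderiv_mollifier_sub (j : ℕ) (x z v : Space n) :
    fderiv ℝ (fun z => mollifier (Space n) j (x - z)) z v
      = -fderiv ℝ (mollifier (Space n) j) (x - z) v := by
  have hmol := ((contDiff_mollifier j).differentiable (by simp) (x - z)).hasFDerivAt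
  have hsub : HasFDerivAt (fun z => mollifier (Space n) j (x - z)) _ z :=
    hmol.comp z ((hasFDerivAt_id z).const_sub x)
  rw [hsub.fderiv]
  simp

namespace HasWeakDeriv

lemma setIntegral_fderiv_mollifier_smul (h : HasWeakDeriv Ω f G) {j : ℕ} {x : Space n}
    (hx : Metric.closedBall x ((1 / 2) ^ j) ⊆ Ω) (v : Space n) :
    ∫ z in Ω, fderiv ℝ (mollifier (Space n) j) (x - z) v • f z
      = ∫ z in Ω, mollifier (Space n) j (x - z) • G z v := by
  have hsupp : tsupport (fun z => mollifier (Space n) j (x - z)) ⊆ Ω := by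
    refine (closure_minimal (fun z hz => ?_) Metric.isClosed_closedBall).trans hx
    rw [Metric.mem_closedBall']
    exact le_of_not_ge fun hz' => hz (mollifier_sub_eq_zero hz')
  have hsmooth : ContDiff ℝ ∞ fun z => mollifier (Space n) j (x - z) :=
    (contDiff_mollifier j).comp (contDiff_const.sub contDiff_id)
  have hparts := h.integral_eq _ hsmooth (hasCompactSupport_mollifier_sub j x) hsupp v
  simpa only [fderiv_mollifier_sub, neg_smul, integral_neg, neg_inj] using hparts

lemma hasFDerivAt_mollify (h : HasWeakDeriv Ω f G) (hΩ : MeasurableSet Ω) (hf : IntegrableOn f Ω)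
    (hG : IntegrableOn G Ω) {j : ℕ} {x : Space n}
    (hx : Metric.closedBall x ((1 / 2) ^ j) ⊆ Ω) :
    HasFDerivAt (mollify j (Ω.indicator f)) (mollify j (Ω.indicator G) x) x := by
  have hf' := locallyIntegrable_indicator hΩ hf
  have hG' := locallyIntegrable_indicator hΩ hG
  refine ((hasCompactSupport_mollifier j).hasFDerivAt_convolution_left
    (ContinuousLinearMap.lsmul ℝ ℝ) ((contDiff_mollifier j).of_le (by norm_cast)) hf'
    x).congr_fderiv ?_
  have hint := (((hasCompactSupport_mollifier (V := Space n) j).fderiv ℝ).convolutionExists_left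
    ((ContinuousLinearMap.lsmul ℝ ℝ).precompL (Space n))
    ((contDiff_mollifier j).continuous_fderiv (by simp)) hf' x).integrable_swap
  ext1 v
  have hparts := h.setIntegral_fderiv_mollifier_smul hx v
  rw [← integral_indicator hΩ, ← integral_indicator hΩ] at hparts
  rw [mollify_apply, convolution_eq_swap, ContinuousLinearMap.integral_apply hint,
    ContinuousLinearMap.integral_apply (integrable_mollifier_sub_smul j hG' x)]
  refine Eq.trans (integral_congr_ae (.of_forall fun z => ?_))
    (hparts.trans (integral_congr_ae (.of_forall fun z => ?_))) <;>
    by_cases hz : z ∈ Ω <;> simp [hz]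

lemma hasMollifiedFDeriv (h : HasWeakDeriv Ω f G) (hΩ : MeasurableSet Ω) (hf : IntegrableOn f Ω)
    (hG : IntegrableOn G Ω) : HasMollifiedFDeriv Ω (Ω.indicator f) (Ω.indicator G) where
  locInt := locallyIntegrable_indicator hΩ hf
  locInt_deriv := locallyIntegrable_indicator hΩ hG
  hasFDerivAt _ _ := h.hasFDerivAt_mollify hΩ hf hG

end HasWeakDeriv

lemma integrable_testFun_smul {E : Type*} [NormedAddCommGroup E] [NormedSpace ℝ E]
    {g : Space n → E} (hg : LocallyIntegrableOn g Ω) {ψ : Space n → ℝ} (hψ : Continuous ψ)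
    (hc : HasCompactSupport ψ) (hs : tsupport ψ ⊆ Ω) :
    Integrable (fun x => ψ x • g x) :=
  (integrableOn_iff_integrable_of_support_subset
    ((Function.support_smul_subset_left ψ g).trans (subset_tsupport ψ))).1
    ((hg.integrableOn_compact_subset hs hc).continuousOn_smul hψ.continuousOn hc)

lemma HasWeakDeriv.ae_eq (hΩ : IsOpen Ω) (h : HasWeakDeriv Ω f G) (h' : HasWeakDeriv Ω f G') :
    G =ᵐ[volume.restrict Ω] G' := by
  suffices key : ∀ᵐ x, x ∈ Ω → G x - G' x = 0 from
    (ae_restrict_iff' hΩ.measurableSet).2 (key.mono fun x hx hxΩ => sub_eq_zero.1 (hx hxΩ))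
  refine hΩ.ae_eq_zero_of_integral_contDiff_smul_eq_zero
    (h.locInt_deriv.sub h'.locInt_deriv) fun ψ hψ hc hs => ?_
  have hi := integrable_testFun_smul h.locInt_deriv hψ.continuous hc hs
  have hi' := integrable_testFun_smul h'.locInt_deriv hψ.continuous hc hs
  have hext : ∀ (H : Space n → (Space n →L[ℝ] Space n)) (v : Space n),
      ∫ x in Ω, ψ x • H x v = ∫ x, ψ x • H x v := fun H v =>
    setIntegral_eq_integral_of_forall_compl_eq_zero fun x hx => by
      rw [image_eq_zero_of_notMem_tsupport fun hx' => hx (hs hx'), zero_smul]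
  simp only [smul_sub]
  rw [integral_sub hi hi', sub_eq_zero]
  ext1 v
  rw [ContinuousLinearMap.integral_apply hi, ContinuousLinearMap.integral_apply hi']
  have hparts := h.integral_eq ψ hψ hc hs v
  rw [h'.integral_eq ψ hψ hc hs v, neg_inj, hext, hext] at hparts
  exact hparts.symm

namespace MemSobolev

lemma hasWeakDeriv (h : MemSobolev Ω p f) : HasWeakDeriv Ω f (weakDeriv Ω f) := by
  obtain ⟨-, G, hG, -⟩ := h
  have hex : ∃ G, HasWeakDeriv Ω f G := ⟨G, hG⟩
  rw [weakDeriv, dif_pos hex]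
  exact hex.choose_spec

lemma integrableOn (h : MemSobolev Ω p f) (hp : 1 ≤ p) (hfin : volume Ω ≠ ⊤) :
    IntegrableOn f Ω := by
  have : IsFiniteMeasure (volume.restrict Ω) := isFiniteMeasure_restrict.2 hfin
  exact h.1.integrable (by simpa using ENNReal.ofReal_le_ofReal hp)

lemma integrableOn_weakDeriv (h : MemSobolev Ω p f) (hΩ : IsOpen Ω) (hp : 1 ≤ p)
    (hfin : volume Ω ≠ ⊤) : IntegrableOn (weakDeriv Ω f) Ω := by
  have : IsFiniteMeasure (volume.restrict Ω) := isFiniteMeasure_restrict.2 hfin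
  obtain ⟨-, G, hG, hGp⟩ := id h
  have hi : IntegrableOn G Ω := hGp.integrable (by simpa using ENNReal.ofReal_le_ofReal hp)
  exact hi.congr (hG.ae_eq hΩ h.hasWeakDeriv)

lemma hasMollifiedFDeriv (h : MemSobolev Ω p f) (hΩ : IsOpen Ω) (hp : 1 ≤ p)
    (hfin : volume Ω ≠ ⊤) :
    HasMollifiedFDeriv Ω (Ω.indicator f) (Ω.indicator (weakDeriv Ω f)) :=
  h.hasWeakDeriv.hasMollifiedFDeriv hΩ.measurableSet (h.integrableOn hp hfin)
    (h.integrableOn_weakDeriv hΩ hp hfin)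

end MemSobolev

end WeakDeriv

/-! ### Differentiability on large sets -/

section UniformConvergence

variable {α β : Type*} [MeasurableSpace α] {μ : Measure α} [IsFiniteMeasure μ] [MetricSpace β]

lemma exists_seq_tendstoUniformlyOn_of_stronglyMeasurable {F : ℕ → α → β} {g : α → β}
    (hF : ∀ j, StronglyMeasurable (F j)) (hg : StronglyMeasurable g)
    (hlim : ∀ᵐ x ∂μ, Tendsto (F · x) atTop (𝓝 (g x))) :
    ∃ S : ℕ → Set α, (∀ m, MeasurableSet (S m)) ∧ (∀ᵐ x ∂μ, ∃ m, x ∈ S m) ∧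
      ∀ m, TendstoUniformlyOn F g atTop (S m) := by
  choose t htm htμ ht using fun m : ℕ => tendstoUniformlyOn_of_ae_tendsto' hF hg hlim
    (ε := 1 / ((m : ℝ) + 1)) (by positivity)
  refine ⟨fun m => (t m)ᶜ, fun m => (htm m).compl, ?_, ht⟩
  have hle : ∀ m : ℕ, μ {x | ¬∃ m, x ∈ (t m)ᶜ} ≤ ENNReal.ofReal (1 / ((m : ℝ) + 1)) := fun m =>
    (measure_mono fun x (hx : ¬_) => not_not.1 fun hxm => hx ⟨m, hxm⟩).trans (htμ m)
  have hzero := ENNReal.tendsto_ofReal tendsto_one_div_add_atTop_nhds_zero_nat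
  rw [ENNReal.ofReal_zero] at hzero
  exact le_antisymm (ge_of_tendsto' hzero hle) bot_le

lemma exists_seq_tendstoUniformlyOn {F : ℕ → α → β} {g : α → β}
    (hF : ∀ j, AEStronglyMeasurable (F j) μ) (hlim : ∀ᵐ x ∂μ, Tendsto (F · x) atTop (𝓝 (g x)))
    {P : α → Prop} (hP : ∀ᵐ x ∂μ, P x) :
    ∃ S : ℕ → Set α, (∀ m, MeasurableSet (S m)) ∧ (∀ᵐ x ∂μ, ∃ m, x ∈ S m) ∧
      ∀ m, (∀ x ∈ S m, P x) ∧ TendstoUniformlyOn F g atTop (S m) := by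
  have hg := aestronglyMeasurable_of_tendsto_ae atTop hF hlim
  have hFeq := ae_all_iff.2 fun j => (hF j).ae_eq_mk
  obtain ⟨S, hSm, hScov, hS⟩ := exists_seq_tendstoUniformlyOn_of_stronglyMeasurable (μ := μ)
    (fun j => (hF j).stronglyMeasurable_mk) hg.stronglyMeasurable_mk (by
      filter_upwards [hlim, hFeq, hg.ae_eq_mk] with x hx hxF hxg
      simpa only [← hxF, ← hxg] using hx)
  obtain ⟨N, hbad, hNm, hN⟩ := exists_measurable_superset_of_null
    (hFeq.and (hg.ae_eq_mk.and hP))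
  have hgood : ∀ x ∉ N, (∀ j, F j x = (hF j).mk _ x) ∧ g x = hg.mk g x ∧ P x := fun x hx =>
    not_not.1 fun hx' => hx (hbad hx')
  refine ⟨fun m => S m \ N, fun m => (hSm m).diff hNm, ?_, fun m =>
    ⟨fun x hx => (hgood x hx.2).2.2, ?_⟩⟩
  · filter_upwards [hScov, measure_eq_zero_iff_ae_notMem.1 hN] with x ⟨m, hm⟩ hxN using ⟨m, hm, hxN⟩
  · refine (((hS m).mono sdiff_subset).congr (.of_forall fun j x hx => ?_)).congr_right
      fun x hx => ?_
    · exact ((hgood x hx.2).1 j).symm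
    · exact (hgood x hx.2).2.1.symm

end UniformConvergence

lemma eventually_closedBall_subset {X : Type*} [PseudoMetricSpace X] {Ω : Set X}
    (hΩ : IsOpen Ω) {x : X} (hx : x ∈ Ω) :
    ∀ᶠ j : ℕ in atTop, Metric.closedBall x (2 * (1 / 2) ^ j) ⊆ Ω := by
  obtain ⟨ε, hε, h⟩ := Metric.isOpen_iff.1 hΩ x hx
  have hlim := tendsto_half_pow.const_mul 2
  rw [mul_zero] at hlim
  filter_upwards [hlim.eventually_lt_const hε] with j hj
  exact (Metric.closedBall_subset_ball hj).trans h

namespace HasMollifiedFDeriv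

variable {V : Type*} [NormedAddCommGroup V] [InnerProductSpace ℝ V] [FiniteDimensional ℝ V]
  [MeasurableSpace V] [BorelSpace V] {E : Type*} [NormedAddCommGroup E] [NormedSpace ℝ E]
  [CompleteSpace E] {Ω : Set V} {f : V → E} {G : V → V →L[ℝ] E}

lemma tendsto_two_pow_mul_dist (h : HasMollifiedFDeriv Ω f G) (hΩ : IsOpen Ω) {x : V} (hx : x ∈ Ω)
    (hlim : Tendsto (mollify · f x) atTop (𝓝 (f x)))
    (hdev : Tendsto (fun j => meanDeviation G j x (G x)) atTop (𝓝 0)) :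
    Tendsto (fun j : ℕ => 2 ^ j * dist (mollify j f x) (f x)) atTop (𝓝 0) := by
  rw [Metric.tendsto_atTop]
  intro ε hε
  have hdev' := hdev.const_mul ((8 : ℝ) ^ Module.finrank ℝ V)
  rw [mul_zero] at hdev'
  obtain ⟨J, hJ⟩ := eventually_atTop.1 ((eventually_closedBall_subset hΩ hx).and
    (hdev'.eventually_le_const (show 0 < ε / 8 by positivity)))
  refine ⟨J, fun j hj => ?_⟩
  have hstep : ∀ i, dist (mollify (i + j) f x) (mollify (i + 1 + j) f x)
      ≤ ε / 2 * (1 / 2) ^ j / 2 / 2 ^ i := fun i => by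
    obtain ⟨hball, hdev⟩ := hJ (i + j) (by omega)
    rw [add_right_comm]
    calc _ ≤ 2 * (8 ^ Module.finrank ℝ V * meanDeviation G (i + j) x (G x)) * (1 / 2) ^ (i + j) :=
          h.dist_mollify_succ_le hball (G x)
      _ ≤ 2 * (ε / 8) * (1 / 2) ^ (i + j) := by gcongr
      _ = _ := by rw [pow_add, one_div, inv_pow, inv_pow]; field_simp; ring
  have hdist := dist_le_of_le_geometric_two_of_tendsto₀ hstep
    ((tendsto_add_atTop_iff_nat j).2 hlim)
  rw [zero_add] at hdist
  rw [dist_zero_right, Real.norm_of_nonneg (by positivity)]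
  calc _ ≤ 2 ^ j * (ε / 2 * (1 / 2) ^ j) := by gcongr
    _ = ε / 2 := by rw [one_div, inv_pow]; field_simp
    _ < ε := half_lt_self hε

lemma norm_sub_sub_le (h : HasMollifiedFDeriv Ω f G) {j : ℕ} {x y : V}
    (hx : Metric.closedBall x (2 * (1 / 2) ^ j) ⊆ Ω) (hlower : (1 / 2) ^ (j + 1) < dist y x)
    (hupper : dist y x ≤ (1 / 2) ^ j) (L : V →L[ℝ] E) :
    ‖f y - f x - L (y - x)‖ ≤ (8 ^ Module.finrank ℝ V * meanDeviation G j x L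
      + 2 * (2 ^ j * dist (mollify j f x) (f x)) + 2 * (2 ^ j * dist (mollify j f y) (f y)))
        * ‖y - x‖ := by
  have hmol := h.norm_mollify_image_sub_le le_rfl (Nat.le_succ j) hx hupper L
  have hscale : ∀ z,
      ‖mollify j f z - f z‖ ≤ 2 * (2 ^ j * dist (mollify j f z) (f z)) * ‖y - x‖ := fun z => by
    have hone : 1 ≤ 2 * 2 ^ j * ‖y - x‖ := by
      have : (2 : ℝ) ^ (j + 1) * (1 / 2) ^ (j + 1) = 1 := by rw [← mul_pow]; norm_num
      rw [← this, ← dist_eq_norm, pow_succ' 2]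
      gcongr
    rw [← dist_eq_norm]
    nlinarith [mul_le_mul_of_nonneg_left hone (dist_nonneg (x := mollify j f z) (y := f z))]
  have hsplit : f y - f x - L (y - x) = (mollify j f y - mollify j f x - L (y - x))
      + (mollify j f x - f x) - (mollify j f y - f y) := by abel
  rw [hsplit]
  linarith [norm_sub_le (mollify j f y - mollify j f x - L (y - x) + (mollify j f x - f x))
    (mollify j f y - f y), norm_add_le (mollify j f y - mollify j f x - L (y - x))
    (mollify j f x - f x), hscale x, hscale y]

lemma hasFDerivWithinAt (h : HasMollifiedFDeriv Ω f G) (hΩ : IsOpen Ω) {S : Set V}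
    (hunif : TendstoUniformlyOn (fun (j : ℕ) x => 2 ^ j * dist (mollify j f x) (f x)) 0 atTop S)
    {x : V} (hxΩ : x ∈ Ω) (hxS : x ∈ S)
    (hdev : Tendsto (fun j => meanDeviation G j x (G x)) atTop (𝓝 0)) :
    HasFDerivWithinAt f (G x) S x := by
  rw [hasFDerivWithinAt_iff_isLittleO, Asymptotics.isLittleO_iff]
  intro c hc
  have hdev' := hdev.const_mul ((8 : ℝ) ^ Module.finrank ℝ V)
  rw [mul_zero] at hdev'
  obtain ⟨J, hJ⟩ := eventually_atTop.1 ((eventually_closedBall_subset hΩ hxΩ).and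
    ((hdev'.eventually_le_const (show 0 < c / 5 by positivity)).and
      (Metric.tendstoUniformlyOn_iff.1 hunif (c / 5) (by positivity))))
  filter_upwards [self_mem_nhdsWithin, mem_nhdsWithin_of_mem_nhds
    (Metric.ball_mem_nhds x (show (0 : ℝ) < (1 / 2) ^ J by positivity))] with y hyS hyx
  rcases eq_or_ne y x with rfl | hne
  · simp
  obtain ⟨j, hlower, hupper⟩ := exists_nat_pow_near_of_lt_one (dist_pos.2 hne)
    ((Metric.mem_ball.1 hyx).le.trans (pow_le_one₀ (by norm_num) (by norm_num)))
    (y := (1 / 2 : ℝ)) (by norm_num) (by norm_num)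
  have hj : J ≤ j := by
    by_contra! hcon
    exact ((Metric.mem_ball.1 hyx).trans_le (half_pow_le_half_pow hcon)).not_gt hlower
  obtain ⟨hball, hmean, hclose⟩ := hJ j hj
  have hclose' : ∀ z ∈ S, 2 ^ j * dist (mollify j f z) (f z) ≤ c / 5 := fun z hz => by
    have := (hclose z hz).le
    rwa [Pi.zero_apply, dist_zero_left, Real.norm_of_nonneg (by positivity)] at this
  refine (h.norm_sub_sub_le hball hlower hupper (G x)).trans ?_
  gcongr
  linarith [hclose' x hxS, hclose' y hyS]

end HasMollifiedFDeriv

lemma HasWeakDeriv.exists_hasFDerivWithinAt {n : ℕ} {Ω : Set (Space n)} {f : Space n → Space n}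
    {G : Space n → Space n →L[ℝ] Space n} (h : HasWeakDeriv Ω f G) (hΩ : IsOpen Ω)
    (hfin : volume Ω ≠ ⊤) (hf : IntegrableOn f Ω) (hG : IntegrableOn G Ω) :
    ∃ S : ℕ → Set (Space n), (∀ m, MeasurableSet (S m)) ∧ volume (Ω \ ⋃ m, S m) = 0 ∧
      ∀ m, ∀ x ∈ S m, HasFDerivWithinAt f (G x) (S m) x := by
  have : IsFiniteMeasure (volume.restrict Ω) := isFiniteMeasure_restrict.2 hfin
  have hmol := h.hasMollifiedFDeriv hΩ.measurableSet hf hG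
  have hdev := ae_restrict_of_ae (s := Ω) (ae_tendsto_meanDeviation hmol.locInt_deriv)
  have hlim : ∀ᵐ x ∂volume.restrict Ω, Tendsto (fun j : ℕ =>
      2 ^ j * dist (mollify j (Ω.indicator f) x) (Ω.indicator f x)) atTop (𝓝 0) := by
    filter_upwards [ae_restrict_mem hΩ.measurableSet, hdev,
      ae_restrict_of_ae (ae_tendsto_mollify hmol.locInt)] with x hx hdev hlim
    exact hmol.tendsto_two_pow_mul_dist hΩ hx hlim hdev
  obtain ⟨S, hSm, hScov, hS⟩ := exists_seq_tendstoUniformlyOn (fun j =>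
    (((continuous_mollify j hmol.locInt).aestronglyMeasurable.dist
      hmol.locInt.aestronglyMeasurable).const_mul _).restrict) hlim
    ((ae_restrict_mem hΩ.measurableSet).and hdev)
  refine ⟨S, hSm, ?_, fun m x hx => ?_⟩
  · rw [ae_restrict_iff' hΩ.measurableSet] at hScov
    exact measure_mono_null (fun x hx (hx' : _ → _) => hx.2 (mem_iUnion.2 (hx' hx.1))) hScov
  · obtain ⟨hgood, hunif⟩ := hS m
    have hderiv := hmol.hasFDerivWithinAt hΩ hunif (hgood x hx).1 hx (hgood x hx).2
    rw [indicator_of_mem (hgood x hx).1] at hderiv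
    exact hderiv.congr' (fun y hy => (indicator_of_mem (hgood y hy).1 f).symm) hx

/-! ### Change of variables -/

section Area

variable {V : Type*} [NormedAddCommGroup V] [NormedSpace ℝ V] [FiniteDimensional ℝ V]
  [MeasurableSpace V] [BorelSpace V] (μ : Measure V) [μ.IsAddHaarMeasure] {f : V → V}
  {G : V → V →L[ℝ] V} {S : ℕ → Set V} {T : Set V}

lemma lintegral_abs_det_eq_of_subset_iUnion (hS : ∀ m, MeasurableSet (S m))
    (hf : ∀ m, ∀ x ∈ S m, HasFDerivWithinAt f (G x) (S m) x) (hT : MeasurableSet T)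
    (hTS : T ⊆ ⋃ m, S m) (hinj : InjOn f T) :
    ∫⁻ x in T, ENNReal.ofReal |(G x).det| ∂μ = μ (f '' T) := by
  set R : ℕ → Set V := disjointed fun m => S m ∩ T
  have hRsub : ∀ m, R m ⊆ S m ∩ T := fun m => disjointed_subset _ m
  have hRm : ∀ m, MeasurableSet (R m) := .disjointed fun m => (hS m).inter hT
  have hRd : Pairwise (Function.onFun Disjoint R) := disjoint_disjointed _
  have hRT : ⋃ m, R m = T := by
    rw [iUnion_disjointed, ← iUnion_inter, inter_eq_right.2 hTS]
  have hRf : ∀ m, ∀ x ∈ R m, HasFDerivWithinAt f (G x) (R m) x := fun m x hx =>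
    (hf m x (hRsub m hx).1).mono ((hRsub m).trans inter_subset_left)
  have hRinj : ∀ m, InjOn f (R m) := fun m => hinj.mono ((hRsub m).trans inter_subset_right)
  rw [← hRT, lintegral_iUnion hRm hRd, image_iUnion, measure_iUnion]
  · exact tsum_congr fun m =>
      lintegral_abs_det_fderiv_eq_addHaar_image μ (hRm m) (hRf m) (hRinj m)
  · exact fun i j hij => (hRd hij).image hinj ((hRsub i).trans inter_subset_right)
      ((hRsub j).trans inter_subset_right)
  · exact fun m => measurable_image_of_fderivWithin (hRm m) (hRf m) (hRinj m)

end Area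

section ChangeOfVariables

variable {n : ℕ} {Ω : Set (Space n)} {f f₀ : Space n → Space n} {p : ℝ}
  {A B T : Set (Space n)}

theorem HasWeakDeriv.lintegral_abs_det_eq {G : Space n → (Space n →L[ℝ] Space n)}
    (h : HasWeakDeriv Ω f G) (hΩ : IsOpen Ω) (hfin : volume Ω ≠ ⊤) (hf : IntegrableOn f Ω)
    (hG : IntegrableOn G Ω) (hN : LusinN Ω f) (hTm : MeasurableSet T) (hT : T ⊆ Ω)
    (hinj : InjOn f T) :
    ∫⁻ x in T, ENNReal.ofReal |(G x).det| = volume (f '' T) := by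
  obtain ⟨S, hSm, hS, hSf⟩ := h.exists_hasFDerivWithinAt hΩ hfin hf hG
  have hrest : volume (T \ ⋃ m, S m) = 0 := measure_mono_null (sdiff_subset_sdiff_left hT) hS
  have hae : (T ∩ ⋃ m, S m : Set (Space n)) =ᵐ[volume] T :=
    inter_subset_left.eventuallyLE.antisymm (ae_le_set.2 (by rwa [sdiff_self_inter]))
  have himage : volume (f '' T) = volume (f '' (T ∩ ⋃ m, S m)) := by
    conv_lhs => rw [← inter_union_sdiff T (⋃ m, S m), image_union]
    exact measure_congr (union_ae_eq_left_of_ae_eq_empty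
      (ae_eq_empty.2 (hN _ (sdiff_subset.trans hT) hrest)))
  rw [← setLIntegral_congr hae, himage]
  exact lintegral_abs_det_eq_of_subset_iUnion volume hSm hSf (hTm.inter (.iUnion hSm))
    inter_subset_right (hinj.mono inter_subset_left)

end ChangeOfVariables

section ChangeOfVariables

variable {n : ℕ} {Ω : Set (Space n)} {f f₀ : Space n → Space n} {p : ℝ} {A : Set (Space n)}

lemma measurableSet_inter_preimage_of_continuousOn {X Y : Type*} [TopologicalSpace X]
    [MeasurableSpace X] [OpensMeasurableSpace X] [TopologicalSpace Y] [MeasurableSpace Y]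
    [BorelSpace Y] {f : X → Y} {s : Set X} {t : Set Y} (hf : ContinuousOn f s)
    (hs : MeasurableSet s) (ht : MeasurableSet t) : MeasurableSet (s ∩ f ⁻¹' t) := by
  have h : Measurable (s.domRestrict f) := (continuousOn_iff_continuous_domRestrict.1 hf).measurable
  rw [← Subtype.image_preimage_coe]
  exact hs.subtype_image (h ht)

namespace HasCavitySet

lemma exists_isOpen [Nontrivial (Space n)] (h : HasCavitySet Ω p f₀ f A) (hΩ : IsOpen Ω)
    (hbd : volume (f₀ '' frontier Ω) = 0) :
    ∃ U ⊆ Ω, IsOpen U ∧ U =ᵐ[volume] Ω ∧ ContinuousOn f U ∧ InjOn f U ∧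
      f '' U =ᵐ[volume] (closure (f₀ '' Ω) \ A : Set (Space n)) := by
  obtain ⟨m, x, K, -, -, -, hemb, himg, rfl⟩ := h.exists_cavities
  have hfin : (range x).Finite := finite_range x
  have hsub : Ω \ range x ⊆ closure Ω \ range x := sdiff_subset_sdiff_left subset_closure
  refine ⟨Ω \ range x, sdiff_subset, hΩ.sdiff hfin.isClosed,
    sdiff_null_ae_eq_self (hfin.measure_zero volume),
    (continuousOn_iff_continuous_domRestrict.2 hemb.continuous).mono hsub,
    (injOn_iff_injective.2 hemb.injective).mono hsub, ?_⟩
  rw [← himg]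
  refine (image_mono hsub).eventuallyLE.antisymm (ae_le_set.2 (measure_mono_null ?_ hbd))
  rintro _ ⟨⟨y, hy, rfl⟩, hy'⟩
  have hyf : y ∈ frontier Ω :=
    ⟨hy.1, fun hyΩ => hy' ⟨y, ⟨interior_subset hyΩ, hy.2⟩, rfl⟩⟩
  exact ⟨y, hyf, (h.eqOn_frontier hyf).symm⟩

lemma aemeasurable [Nontrivial (Space n)] (h : HasCavitySet Ω p f₀ f A) (hΩ : IsOpen Ω)
    (hbd : volume (f₀ '' frontier Ω) = 0) : AEMeasurable f (volume.restrict Ω) := by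
  obtain ⟨U, -, hU, hUΩ, hf, -⟩ := h.exists_isOpen hΩ hbd
  rw [← Measure.restrict_congr_set hUΩ]
  exact hf.aemeasurable hU.measurableSet

theorem map_withDensity_abs_det [Nontrivial (Space n)] (h : HasCavitySet Ω p f₀ f A) (hp : 1 ≤ p)
    (hΩ : IsOpen Ω) (hfin : volume Ω ≠ ⊤) (hbd : volume (f₀ '' frontier Ω) = 0) :
    ((volume.restrict Ω).withDensity fun x => ENNReal.ofReal |(weakDeriv Ω f x).det|).map f
      = volume.restrict (closure (f₀ '' Ω) \ A) := by
  obtain ⟨U, hUsub, hU, hUΩ, hf, hinj, himg⟩ := h.exists_isOpen hΩ hbd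
  have hfm := h.aemeasurable hΩ hbd
  ext B hB
  have hUB : MeasurableSet (U ∩ f ⁻¹' B) :=
    measurableSet_inter_preimage_of_continuousOn hf hU.measurableSet hB
  rw [Measure.map_apply_of_aemeasurable (hfm.mono_ac (withDensity_absolutelyContinuous _ _)) hB,
    withDensity_apply₀ _ (hfm.nullMeasurable hB), ← Measure.restrict_congr_set hUΩ,
    Measure.restrict_restrict₀ (by
      rw [Measure.restrict_congr_set hUΩ]; exact hfm.nullMeasurable hB),
    inter_comm, h.mem_sobolev.hasWeakDeriv.lintegral_abs_det_eq hΩ hfin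
      (h.mem_sobolev.integrableOn hp hfin) (h.mem_sobolev.integrableOn_weakDeriv hΩ hp hfin)
      h.lusin hUB (inter_subset_left.trans hUsub) (hinj.mono inter_subset_left),
    image_inter_preimage, ← Measure.restrict_congr_set himg, Measure.restrict_apply hB, inter_comm]

end HasCavitySet

end ChangeOfVariables

/-! ### Consequences of the growth of `φ` -/

section Growth

variable {φ : ℝ → ℝ}

lemma exists_forall_le_extend (hφ : Tendsto φ (𝓝[>] 0) atTop) (M : ℝ) :
    ∃ δ > 0, ∀ t ≤ δ, ENNReal.ofReal M ≤ extend φ t := by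
  obtain ⟨δ, hδ, hsub⟩ := mem_nhdsGT_iff_exists_Ioc_subset.1 (hφ.eventually_ge_atTop M)
  refine ⟨δ, hδ, fun t ht => ?_⟩
  rw [extend]
  split_ifs with h0
  · exact ENNReal.ofReal_le_ofReal (hsub ⟨h0, ht⟩)
  · exact le_top

lemma exists_forall_ofReal_abs_le (hφ : Tendsto (fun t => φ t / t) atTop atTop) {ε : ℝ}
    (hε : 0 < ε) :
    ∃ M : ℝ, ∀ t, ENNReal.ofReal |t| ≤ ENNReal.ofReal M + ENNReal.ofReal ε * extend φ t := by
  obtain ⟨M, hM⟩ := eventually_atTop.1 (hφ.eventually_ge_atTop (1 / ε))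
  refine ⟨M, fun t => ?_⟩
  rw [extend]
  split_ifs with ht
  · rw [abs_of_pos ht]
    rcases le_total t M with htM | htM
    · exact (ENNReal.ofReal_le_ofReal htM).trans le_self_add
    · have hφt := hM t htM
      rw [div_le_div_iff₀ hε ht, one_mul, mul_comm] at hφt
      rw [← ENNReal.ofReal_mul hε.le]
      exact (ENNReal.ofReal_le_ofReal hφt).trans le_add_self
  · simp [ENNReal.mul_top, hε]

variable {ι X : Type*} [MeasurableSpace X]

/-- The measures `ρ i` are absolutely continuous with respect to the measures `κ i`, uniformly in
`i`. -/
def UniformlyAbsolutelyContinuous (ρ κ : ι → Measure X) : Prop :=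
  ∀ η : ℝ≥0∞, η ≠ 0 → ∃ δ : ℝ≥0∞, δ ≠ 0 ∧ ∀ i S, κ i S ≤ δ → ρ i S ≤ η

variable {μ : Measure X} {C : ℝ≥0∞}

lemma exists_forall_measure_le_le (hφ : Tendsto φ (𝓝[>] 0) atTop) (hC : C ≠ ⊤) {η : ℝ≥0∞}
    (hη : η ≠ 0) :
    ∃ δ > 0, ∀ J : X → ℝ, AEMeasurable J μ → ∫⁻ x, extend φ (J x) ∂μ ≤ C → μ {x | J x ≤ δ} ≤ η := by
  set M : ℝ := (C / η).toReal + 1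
  have hM0 : ENNReal.ofReal M ≠ 0 := by positivity
  obtain ⟨δ, hδ, h⟩ := exists_forall_le_extend hφ M
  refine ⟨δ, hδ, fun J hJ hE => ?_⟩
  have hCM : C ≤ ENNReal.ofReal M * η := by
    rw [← ENNReal.div_le_iff_le_mul (Or.inl hη) (Or.inr hM0),
      ENNReal.le_ofReal_iff_toReal_le (ENNReal.div_ne_top hC hη) (by positivity)]
    exact le_add_of_nonneg_right zero_le_one
  refine (ENNReal.mul_le_mul_iff_right hM0 ENNReal.ofReal_ne_top).1 (le_trans ?_ hCM)
  calc ENNReal.ofReal M * μ {x | J x ≤ δ}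
      = ∫⁻ x, {x | J x ≤ δ}.indicator (fun _ => ENNReal.ofReal M) x ∂μ :=
        (lintegral_indicator_const₀ (nullMeasurableSet_le hJ aemeasurable_const) _).symm
    _ ≤ ∫⁻ x, extend φ (J x) ∂μ := lintegral_mono (indicator_le fun x hx => h _ hx)
    _ ≤ C := hE

lemma uniformlyAbsolutelyContinuous_withDensity_abs_right (hφ : Tendsto φ (𝓝[>] 0) atTop)
    (hC : C ≠ ⊤) {J : ι → X → ℝ} (hJ : ∀ i, AEMeasurable (J i) μ)
    (hE : ∀ i, ∫⁻ x, extend φ (J i x) ∂μ ≤ C) :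
    UniformlyAbsolutelyContinuous (fun _ => μ)
      (fun i => μ.withDensity fun x => ENNReal.ofReal |J i x|) := by
  intro η hη
  have hη2 : η / 2 ≠ 0 := (ENNReal.half_pos hη).ne'
  obtain ⟨δ, hδ, hsmall⟩ := exists_forall_measure_le_le (μ := μ) hφ hC hη2
  have hδ0 : ENNReal.ofReal δ ≠ 0 := by positivity
  refine ⟨ENNReal.ofReal δ * (η / 2), mul_ne_zero hδ0 hη2, fun i S hS => ?_⟩
  set ρ := μ.withDensity fun x => ENNReal.ofReal |J i x|
  set T := toMeasurable ρ S
  have hlarge : ENNReal.ofReal δ * μ (T ∩ {x | δ < J i x}) ≤ ENNReal.ofReal δ * (η / 2) :=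
    calc ENNReal.ofReal δ * μ (T ∩ {x | δ < J i x})
        ≤ ENNReal.ofReal δ * μ.restrict T {x | ENNReal.ofReal δ ≤ ENNReal.ofReal |J i x|} := by
          refine mul_le_mul_right ?_ _
          rw [inter_comm]
          refine (Measure.le_restrict_apply _ _).trans (measure_mono fun x hx => ?_)
          exact ENNReal.ofReal_le_ofReal (le_of_lt hx |>.trans (le_abs_self _))
      _ ≤ ∫⁻ x in T, ENNReal.ofReal |J i x| ∂μ :=
          mul_meas_ge_le_lintegral₀ (hJ i).abs.ennreal_ofReal.restrict _
      _ = ρ T := (withDensity_apply _ (measurableSet_toMeasurable _ _)).symm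
      _ ≤ ENNReal.ofReal δ * (η / 2) := (measure_toMeasurable S).trans_le hS
  calc μ S ≤ μ ({x | J i x ≤ δ} ∪ T ∩ {x | δ < J i x}) :=
        measure_mono fun x hx => (le_or_gt (J i x) δ).imp id fun h =>
          ⟨subset_toMeasurable _ _ hx, h⟩
    _ ≤ μ {x | J i x ≤ δ} + μ (T ∩ {x | δ < J i x}) := measure_union_le _ _
    _ ≤ η / 2 + η / 2 := add_le_add (hsmall _ (hJ i) (hE i))
        ((ENNReal.mul_le_mul_iff_right hδ0 ENNReal.ofReal_ne_top).1 hlarge)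
    _ = η := ENNReal.add_halves η

lemma exists_forall_setLIntegral_abs_le (hφ : Tendsto (fun t => φ t / t) atTop atTop)
    (hC : C ≠ ⊤) {η : ℝ≥0∞} (hη : η ≠ 0) :
    ∃ M : ℝ, ∀ J : X → ℝ, ∫⁻ x, extend φ (J x) ∂μ ≤ C → ∀ S,
      ∫⁻ x in S, ENNReal.ofReal |J x| ∂μ ≤ ENNReal.ofReal M * μ S + η := by
  obtain ⟨ε, hε, hεC⟩ := ENNReal.exists_nnreal_pos_mul_lt hC hη
  obtain ⟨M, hM⟩ := exists_forall_ofReal_abs_le hφ (NNReal.coe_pos.2 hε)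
  refine ⟨M, fun J hE S => ?_⟩
  calc ∫⁻ x in S, ENNReal.ofReal |J x| ∂μ
      ≤ ∫⁻ x in S, (ENNReal.ofReal M + ENNReal.ofReal ε * extend φ (J x)) ∂μ :=
        lintegral_mono fun x => hM (J x)
    _ = ENNReal.ofReal M * μ S + ε * ∫⁻ x in S, extend φ (J x) ∂μ := by
        rw [lintegral_add_left measurable_const, setLIntegral_const,
          lintegral_const_mul' _ _ ENNReal.ofReal_ne_top, ENNReal.ofReal_coe_nnreal]
    _ ≤ ENNReal.ofReal M * μ S + ε * C := by
        gcongr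
        exact (setLIntegral_le_lintegral _ _).trans hE
    _ ≤ ENNReal.ofReal M * μ S + η := by gcongr

lemma uniformlyAbsolutelyContinuous_withDensity_abs_left
    (hφ : Tendsto (fun t => φ t / t) atTop atTop) (hC : C ≠ ⊤) {J : ι → X → ℝ}
    (hE : ∀ i, ∫⁻ x, extend φ (J i x) ∂μ ≤ C) :
    UniformlyAbsolutelyContinuous (fun i => μ.withDensity fun x => ENNReal.ofReal |J i x|)
      (fun _ => μ) := by
  intro η hη
  have hη2 : η / 2 ≠ 0 := (ENNReal.half_pos hη).ne'
  obtain ⟨M, hM⟩ := exists_forall_setLIntegral_abs_le (μ := μ) hφ hC hη2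
  obtain ⟨δ, hδ, hδM⟩ := ENNReal.exists_nnreal_pos_mul_lt (ENNReal.ofReal_ne_top (r := M)) hη2
  refine ⟨δ, by positivity, fun i S hS => ?_⟩
  calc μ.withDensity (fun x => ENNReal.ofReal |J i x|) S
      ≤ μ.withDensity (fun x => ENNReal.ofReal |J i x|) (toMeasurable μ S) :=
        measure_mono (subset_toMeasurable μ S)
    _ = ∫⁻ x in toMeasurable μ S, ENNReal.ofReal |J i x| ∂μ :=
        withDensity_apply _ (measurableSet_toMeasurable _ _)
    _ ≤ ENNReal.ofReal M * μ S + η / 2 := by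
        simpa only [measure_toMeasurable] using hM _ (hE i) (toMeasurable μ S)
    _ ≤ δ * ENNReal.ofReal M + η / 2 := by
        rw [mul_comm]
        gcongr
    _ ≤ η / 2 + η / 2 := by gcongr
    _ = η := ENNReal.add_halves η

end Growth

/-! ### Limits of maps that transport measures to the complement of a set -/

section Transport

variable {X Y : Type*} [MeasurableSpace X] {μ : Measure X} {u : ℕ → X → Y} {v : X → Y}

lemma measure_preimage_le_of_isOpen [TopologicalSpace Y] {U : Set Y} (hU : IsOpen U)
    (hv : ∀ᵐ x ∂μ, Tendsto (fun k => u k x) atTop (𝓝 (v x))) {b : ℝ≥0∞}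
    (hb : ∀ᶠ k in atTop, μ (u k ⁻¹' U) ≤ b) : μ (v ⁻¹' U) ≤ b := by
  obtain ⟨K, hK⟩ := eventually_atTop.1 hb
  have hmono : Monotone fun m : ℕ => ⋂ k ≥ m, u k ⁻¹' U := fun i j hij =>
    biInter_subset_biInter_left fun k (hk : j ≤ k) => hij.trans hk
  calc μ (v ⁻¹' U) ≤ μ (⋃ m : ℕ, ⋂ k ≥ m, u k ⁻¹' U) := by
        refine measure_mono_ae ?_
        filter_upwards [hv] with x hx hxU
        obtain ⟨m, hm⟩ := eventually_atTop.1 (hx.eventually (hU.mem_nhds hxU))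
        exact mem_iUnion.2 ⟨m, mem_iInter₂.2 hm⟩
    _ = ⨆ m : ℕ, μ (⋂ k ≥ m, u k ⁻¹' U) := hmono.measure_iUnion
    _ ≤ b := iSup_le fun m =>
        (measure_mono (iInter₂_subset (max m K) (le_max_left m K))).trans (hK _ (le_max_right _ _))

lemma tendsto_measure_preimage_zero [TopologicalSpace Y] [MeasurableSpace Y]
    [OpensMeasurableSpace Y] [IsFiniteMeasure μ] {K : Set Y} (hK : IsClosed K)
    (hu : ∀ k, AEMeasurable (u k) μ) (hv : ∀ᵐ x ∂μ, Tendsto (fun k => u k x) atTop (𝓝 (v x)))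
    (h0 : μ (v ⁻¹' K) = 0) :
    Tendsto (fun k => μ (u k ⁻¹' K)) atTop (𝓝 0) := by
  have hanti : Antitone fun m : ℕ => ⋃ k ≥ m, u k ⁻¹' K := fun i j hij =>
    biUnion_subset_biUnion_left fun k (hk : j ≤ k) => hij.trans hk
  have htend := tendsto_measure_iInter_atTop (μ := μ) (s := fun m : ℕ => ⋃ k ≥ m, u k ⁻¹' K)
    (fun m => .iUnion fun k => .iUnion fun _ => (hu k).nullMeasurableSet_preimage hK.measurableSet)
    hanti ⟨0, measure_ne_top _ _⟩
  have hzero : μ (⋂ m : ℕ, ⋃ k ≥ m, u k ⁻¹' K) = 0 := by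
    refine measure_mono_null_ae ?_ h0
    filter_upwards [hv] with x hx hxK
    by_contra hcon
    obtain ⟨m, hm⟩ := eventually_atTop.1 (hx.eventually (hK.isOpen_compl.mem_nhds hcon))
    obtain ⟨k, hk, hk'⟩ := mem_iUnion₂.1 (mem_iInter.1 hxK m)
    exact hm k hk hk'
  rw [hzero] at htend
  refine tendsto_of_tendsto_of_tendsto_of_le_of_le tendsto_const_nhds htend (fun _ => bot_le)
    fun m => measure_mono ?_
  exact subset_biUnion_of_mem (u := fun k => u k ⁻¹' K) (show m ∈ {k | k ≥ m} from le_refl m)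

variable [MeasurableSpace Y] {ν : Measure Y} {ρ : ℕ → Measure X} {A : ℕ → Set Y} {B : Set Y}

lemma measure_sdiff_le (ν : Measure Y) (A B S : Set Y) : ν (S \ A) ≤ ν (S \ B) + ν (A ∆ B) := by
  refine (measure_mono fun x hx => ?_).trans (measure_union_le _ _)
  by_cases hB : x ∈ B
  · exact Or.inr (Or.inr ⟨hB, hx.2⟩)
  · exact Or.inl ⟨hx.1, hB⟩

lemma measure_preimage_eq_of_map_eq_restrict_compl {σ : Measure X} {w : X → Y} {D S : Set Y}
    (hw : AEMeasurable w σ) (h : σ.map w = ν.restrict Dᶜ) (hS : MeasurableSet S) :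
    σ (w ⁻¹' S) = ν (S \ D) := by
  rw [← Measure.map_apply_of_aemeasurable hw hS, h, Measure.restrict_apply hS, sdiff_eq]

lemma measure_sdiff_eq_zero_of_restrict_compl_absolutelyContinuous {B' : Set Y}
    (hB : NullMeasurableSet B ν) (h : ν.restrict B'ᶜ ≪ ν.restrict Bᶜ) : ν (B \ B') = 0 := by
  refine nonpos_iff_eq_zero.1 ((Measure.le_restrict_apply B'ᶜ B).trans (h ?_).le)
  rw [Measure.restrict_apply₀' hB.compl, inter_compl_self, measure_empty]

variable [TopologicalSpace Y] [TopologicalSpace.PseudoMetrizableSpace Y] [BorelSpace Y]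
  [IsFiniteMeasure ν]

theorem map_absolutelyContinuous_restrict_compl (hρ : UniformlyAbsolutelyContinuous (fun _ => μ) ρ)
    (hu : ∀ k, AEMeasurable (u k) (ρ k)) (hmap : ∀ k, (ρ k).map (u k) = ν.restrict (A k)ᶜ)
    (hvm : AEMeasurable v μ) (hv : ∀ᵐ x ∂μ, Tendsto (fun k => u k x) atTop (𝓝 (v x)))
    (hA : Tendsto (fun k => ν (A k ∆ B)) atTop (𝓝 0)) : μ.map v ≪ ν.restrict Bᶜ := by
  refine Measure.AbsolutelyContinuous.mk fun S hS h0 => ?_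
  rw [Measure.map_apply_of_aemeasurable hvm hS]
  refine nonpos_iff_eq_zero.1 (le_of_forall_pos_le_add fun η hη => ?_)
  obtain ⟨δ, hδ, hsmall⟩ := hρ η hη.ne'
  have hδ2 : 0 < δ / 2 := ENNReal.half_pos hδ
  obtain ⟨U, hSU, hU, hUδ⟩ := S.exists_isOpen_lt_of_lt (μ := ν.restrict Bᶜ) (δ / 2) (h0 ▸ hδ2)
  rw [Measure.restrict_apply hU.measurableSet, ← sdiff_eq] at hUδ
  rw [zero_add]
  refine (measure_mono (preimage_mono hSU)).trans (measure_preimage_le_of_isOpen hU hv ?_)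
  filter_upwards [hA.eventually (gt_mem_nhds hδ2)] with k hk
  refine hsmall k _ ?_
  calc ρ k (u k ⁻¹' U) = ν (U \ A k) :=
        measure_preimage_eq_of_map_eq_restrict_compl (hu k) (hmap k) hU.measurableSet
    _ ≤ ν (U \ B) + ν (A k ∆ B) := measure_sdiff_le _ _ _ _
    _ ≤ δ / 2 + δ / 2 := add_le_add hUδ.le hk.le
    _ = δ := ENNReal.add_halves δ

theorem restrict_compl_absolutelyContinuous_map [IsFiniteMeasure μ]
    (hρ : UniformlyAbsolutelyContinuous ρ (fun _ => μ)) (hu : ∀ k, AEMeasurable (u k) μ)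
    (hmap : ∀ k, (ρ k).map (u k) = ν.restrict (A k)ᶜ)
    (hvm : AEMeasurable v μ) (hv : ∀ᵐ x ∂μ, Tendsto (fun k => u k x) atTop (𝓝 (v x)))
    (hA : Tendsto (fun k => ν (A k ∆ B)) atTop (𝓝 0)) : ν.restrict Bᶜ ≪ μ.map v := by
  have hac : ∀ k, ρ k ≪ μ := fun k S hS =>
    nonpos_iff_eq_zero.1 (le_of_forall_pos_le_add fun η hη => by
      obtain ⟨δ, -, hδ⟩ := hρ η hη.ne'
      simpa using hδ k S (hS.trans_le bot_le))
  refine Measure.AbsolutelyContinuous.mk fun S hS h0 => ?_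
  rw [Measure.map_apply_of_aemeasurable hvm hS] at h0
  rw [hS.measure_eq_iSup_isClosed_of_ne_top (measure_ne_top _ _)]
  simp only [ENNReal.iSup_eq_zero]
  intro K hKS hK
  rw [Measure.restrict_apply hK.measurableSet, ← sdiff_eq]
  refine nonpos_iff_eq_zero.1 (le_of_forall_pos_le_add fun η hη => ?_)
  obtain ⟨δ, hδ, hsmall⟩ := hρ (η / 2) (ENNReal.half_pos hη.ne').ne'
  have hKzero := tendsto_measure_preimage_zero hK hu hv (measure_mono_null (preimage_mono hKS) h0)
  obtain ⟨k, hkK, hkA⟩ := ((hKzero.eventually (gt_mem_nhds (pos_iff_ne_zero.2 hδ))).and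
    (hA.eventually (gt_mem_nhds (ENNReal.half_pos hη.ne')))).exists
  calc ν (K \ B) ≤ ν (K \ A k) + ν (B ∆ A k) := measure_sdiff_le _ _ _ _
    _ = ρ k (u k ⁻¹' K) + ν (A k ∆ B) := by
        rw [symmDiff_comm, measure_preimage_eq_of_map_eq_restrict_compl ((hu k).mono_ac (hac k))
          (hmap k) hK.measurableSet]
    _ ≤ η / 2 + η / 2 := add_le_add (hsmall k _ hkK.le) hkA.le
    _ = 0 + η := by rw [ENNReal.add_halves, zero_add]

end Transport

/-! ### Rellich compactness -/

section MollificationError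

variable {V : Type*} [NormedAddCommGroup V] [InnerProductSpace ℝ V] [FiniteDimensional ℝ V]
  [MeasurableSpace V] [BorelSpace V]

section MeanDeviation

variable {E : Type*} [NormedAddCommGroup E] {g : V → E}

lemma ofReal_meanDeviation_zero (hg : LocallyIntegrable g) (j : ℕ) (x : V) :
    ENNReal.ofReal (meanDeviation g j x 0) =
      ∫⁻ z, ‖g (z + x)‖ₑ
        ∂ProbabilityTheory.cond volume (Metric.closedBall 0 (2 * (1 / 2) ^ j)) := by
  set r : ℝ := 2 * (1 / 2) ^ j
  have hr : 0 < r := by positivity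
  have hball : (· + x) ⁻¹' Metric.closedBall x r = Metric.closedBall 0 r := by
    ext z
    simp
  have hpos : volume (Metric.closedBall x r) ≠ 0 := (Metric.measure_closedBall_pos _ _ hr).ne'
  have hint : IntegrableOn g (Metric.closedBall x r) :=
    hg.integrableOn_isCompact (isCompact_closedBall x r)
  simp only [meanDeviation, sub_zero, ProbabilityTheory.cond, lintegral_smul_measure, smul_eq_mul]
  rw [setAverage_eq, smul_eq_mul, ENNReal.ofReal_mul (by positivity),
    ofReal_integral_norm_eq_lintegral_enorm hint, ← hball,
    (measurePreserving_add_right volume x).setLIntegral_comp_preimage_emb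
      (measurableEmbedding_addRight x) (fun z => ‖g z‖ₑ), hball,
    ← Measure.addHaar_closedBall_center volume x r, measureReal_def,
    ENNReal.ofReal_inv_of_pos (ENNReal.toReal_pos hpos measure_closedBall_lt_top.ne),
    ENNReal.ofReal_toReal measure_closedBall_lt_top.ne]

lemma aemeasurable_enorm_add (hg : AEStronglyMeasurable g) (σ : Measure V) [SFinite σ] :
    AEMeasurable (fun q : V × V => ‖g (q.2 + q.1)‖ₑ) (volume.prod σ) :=
  hg.enorm.comp_quasiMeasurePreserving (quasiMeasurePreserving_add_swap volume σ)

lemma aemeasurable_ofReal_meanDeviation_zero (hg : LocallyIntegrable g) (j : ℕ) :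
    AEMeasurable fun x => ENNReal.ofReal (meanDeviation g j x 0) := by
  simp only [ofReal_meanDeviation_zero hg]
  exact (aemeasurable_enorm_add hg.aestronglyMeasurable _).lintegral_prod_right'

lemma lintegral_ofReal_meanDeviation_zero (hg : LocallyIntegrable g) (j : ℕ) :
    ∫⁻ x, ENNReal.ofReal (meanDeviation g j x 0) = ∫⁻ x, ‖g x‖ₑ := by
  have hprob : IsProbabilityMeasure
      (ProbabilityTheory.cond (volume : Measure V) (Metric.closedBall 0 (2 * (1 / 2) ^ j))) :=
    ProbabilityTheory.cond_isProbabilityMeasure_of_finite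
      (Metric.measure_closedBall_pos _ _ (by positivity)).ne' measure_closedBall_lt_top.ne
  simp only [ofReal_meanDeviation_zero hg]
  rw [lintegral_lintegral_swap (aemeasurable_enorm_add hg.aestronglyMeasurable _)]
  simp only [lintegral_add_left_eq_self (fun y => ‖g y‖ₑ), lintegral_const, measure_univ, mul_one]

end MeanDeviation

variable {E : Type*} [NormedAddCommGroup E] [NormedSpace ℝ E] {Ω : Set V} {f : V → E}
  {G : V → V →L[ℝ] E}

namespace HasMollifiedFDeriv

lemma edist_mollify_succ_le [CompleteSpace E] (h : HasMollifiedFDeriv Ω f G) {i j : ℕ} {x : V}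
    (hx : Metric.closedBall x (2 * (1 / 2) ^ j) ⊆ Ω) :
    edist (mollify (i + j) f x) (mollify (i + 1 + j) f x) ≤
      2 * 8 ^ Module.finrank ℝ V * 2⁻¹ ^ (i + j) *
        ENNReal.ofReal (meanDeviation G (i + j) x 0) := by
  have hx' : Metric.closedBall x (2 * (1 / 2) ^ (i + j)) ⊆ Ω :=
    (Metric.closedBall_subset_closedBall
      (by gcongr 2 * ?_; exact half_pow_le_half_pow (Nat.le_add_left j i))).trans hx
  rw [edist_dist, Nat.add_right_comm]
  refine (ENNReal.ofReal_le_ofReal (h.dist_mollify_succ_le hx' 0)).trans_eq ?_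
  have hhalf : ENNReal.ofReal (1 / 2) = 2⁻¹ := by
    rw [one_div, ENNReal.ofReal_inv_of_pos two_pos, ENNReal.ofReal_ofNat]
  rw [← mul_assoc, mul_right_comm, ENNReal.ofReal_mul (by positivity),
    ENNReal.ofReal_mul (by positivity), ENNReal.ofReal_mul (by positivity),
    ENNReal.ofReal_pow (by positivity), ENNReal.ofReal_pow (by positivity), hhalf,
    ENNReal.ofReal_ofNat, ENNReal.ofReal_ofNat]

lemma lintegral_edist_mollify_le [CompleteSpace E] (h : HasMollifiedFDeriv Ω f G) (j : ℕ) :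
    ∫⁻ x in (Metric.cthickening (2 * (1 / 2) ^ j) Ωᶜ)ᶜ, edist (mollify j f x) (f x)
      ≤ 4 * 8 ^ Module.finrank ℝ V * (∫⁻ x, ‖G x‖ₑ) * 2⁻¹ ^ j := by
  set d : ℕ → V → ℝ≥0∞ := fun i x =>
    2 * 8 ^ Module.finrank ℝ V * 2⁻¹ ^ (i + j) * ENNReal.ofReal (meanDeviation G (i + j) x 0)
  have hsum : ∀ᵐ x ∂volume.restrict (Metric.cthickening (2 * (1 / 2) ^ j) Ωᶜ)ᶜ,
      edist (mollify j f x) (f x) ≤ ∑' i, d i x := by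
    filter_upwards [ae_restrict_of_ae (ae_tendsto_mollify h.locInt),
      ae_restrict_mem Metric.isClosed_cthickening.measurableSet.compl] with x hx hxΩ
    have hball : Metric.closedBall x (2 * (1 / 2) ^ j) ⊆ Ω := fun y hy => by
      by_contra hyΩ
      exact hxΩ (Metric.mem_cthickening_of_dist_le _ y _ _ hyΩ (Metric.mem_closedBall'.1 hy))
    simpa only [zero_add] using edist_le_tsum_of_edist_le_of_tendsto₀ (fun i => d i x)
      (fun i => h.edist_mollify_succ_le hball) ((tendsto_add_atTop_iff_nat j).2 hx)
  have hterm : ∀ i, ∫⁻ x, d i x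
      = 2⁻¹ ^ i * (2 * 8 ^ Module.finrank ℝ V * (∫⁻ x, ‖G x‖ₑ) * 2⁻¹ ^ j) := fun i => by
    rw [lintegral_const_mul'' _ (aemeasurable_ofReal_meanDeviation_zero h.locInt_deriv _),
      lintegral_ofReal_meanDeviation_zero h.locInt_deriv]
    ring
  calc ∫⁻ x in (Metric.cthickening (2 * (1 / 2) ^ j) Ωᶜ)ᶜ, edist (mollify j f x) (f x)
      ≤ ∫⁻ x, ∑' i, d i x := (lintegral_mono_ae hsum).trans (setLIntegral_le_lintegral _ _)
    _ = ∑' i, 2⁻¹ ^ i * (2 * 8 ^ Module.finrank ℝ V * (∫⁻ x, ‖G x‖ₑ) * 2⁻¹ ^ j) := by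
        exact (lintegral_tsum fun i => (aemeasurable_ofReal_meanDeviation_zero
          h.locInt_deriv _).const_mul _).trans (tsum_congr hterm)
    _ = 4 * 8 ^ Module.finrank ℝ V * (∫⁻ x, ‖G x‖ₑ) * 2⁻¹ ^ j := by
        rw [ENNReal.tsum_mul_right, ENNReal.tsum_geometric_two]
        ring

lemma measure_le_edist_mollify_le [CompleteSpace E] (h : HasMollifiedFDeriv Ω f G) (j : ℕ)
    {ε : ℝ≥0∞} (hε : ε ≠ 0) (hε' : ε ≠ ⊤) :
    volume.restrict Ω {x | ε ≤ edist (mollify j f x) (f x)} ≤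
      volume.restrict Ω (Metric.cthickening (2 * (1 / 2) ^ j) Ωᶜ) +
        4 * 8 ^ Module.finrank ℝ V * (∫⁻ x, ‖G x‖ₑ) * 2⁻¹ ^ j / ε := by
  set T := Metric.cthickening (2 * (1 / 2) ^ j) Ωᶜ
  set S := {x | ε ≤ edist (mollify j f x) (f x)}
  have hT : MeasurableSet T := Metric.isClosed_cthickening.measurableSet
  have hmeas : AEMeasurable (fun x => edist (mollify j f x) (f x)) :=
    (continuous_mollify j h.locInt).aestronglyMeasurable.edist h.locInt.aestronglyMeasurable
  calc volume.restrict Ω S ≤ volume.restrict Ω T + volume.restrict Ω (S \ T) :=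
        (measure_mono fun x hx => (em (x ∈ T)).imp_right fun hxT => ⟨hx, hxT⟩).trans
          (measure_union_le _ _)
    _ ≤ volume.restrict Ω T + volume.restrict Tᶜ S := by
        refine add_le_add le_rfl ?_
        rw [Measure.restrict_apply' hT.compl]
        exact Measure.restrict_apply_le _ _
    _ ≤ _ := by
        gcongr
        exact (meas_ge_le_lintegral_div hmeas.restrict hε hε').trans
          (ENNReal.div_le_div_right (h.lintegral_edist_mollify_le j) _)

end HasMollifiedFDeriv

lemma tendsto_measure_restrict_cthickening_compl {Ω : Set V} (hΩ : IsOpen Ω) (hfin : volume Ω ≠ ⊤) :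
    Tendsto (fun j : ℕ => volume.restrict Ω (Metric.cthickening (2 * (1 / 2) ^ j) Ωᶜ)) atTop
      (𝓝 0) := by
  have : IsFiniteMeasure (volume.restrict Ω) := isFiniteMeasure_restrict.2 hfin
  have hzero : volume.restrict Ω Ωᶜ = 0 := by
    rw [Measure.restrict_apply' hΩ.measurableSet, compl_inter_self, measure_empty]
  rw [← hzero]
  refine (tendsto_measure_cthickening_of_isClosed ⟨1, one_pos, measure_ne_top _ _⟩
    hΩ.isClosed_compl).comp ?_
  simpa using tendsto_half_pow.const_mul 2

end MollificationError

lemma tendstoInMeasure_of_forall_exists_approx {α E ι κ : Type*} [MeasurableSpace α]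
    {μ : Measure α} [PseudoEMetricSpace E] {l : Filter ι} {u : ι → α → E} {v : α → E}
    {U : κ → ι → α → E} {W : κ → α → E} (hU : ∀ j, TendstoInMeasure μ (U j) l (W j))
    (h : ∀ ε : ℝ≥0∞, 0 < ε → ε ≠ ⊤ → ∀ η : ℝ≥0∞, 0 < η → ∃ j,
      (∀ i, μ {x | ε ≤ edist (U j i x) (u i x)} ≤ η) ∧ μ {x | ε ≤ edist (W j x) (v x)} ≤ η) :
    TendstoInMeasure μ u l v := by
  refine tendstoInMeasure_of_ne_top fun ε hε hεtop => ?_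
  have hε3 : 0 < ε / 3 := ENNReal.div_pos hε.ne' (by norm_num)
  rw [ENNReal.tendsto_nhds_zero]
  intro η hη
  have hη3 : 0 < η / 3 := ENNReal.div_pos hη.ne' (by norm_num)
  obtain ⟨j, hu, hv⟩ := h (ε / 3) hε3 (ENNReal.div_lt_top hεtop (by norm_num)).ne (η / 3) hη3
  filter_upwards [(hU j (ε / 3) hε3).eventually (gt_mem_nhds hη3)] with i hi
  have hsub : {x | ε ≤ edist (u i x) (v x)} ⊆ {x | ε / 3 ≤ edist (U j i x) (u i x)} ∪
      {x | ε / 3 ≤ edist (U j i x) (W j x)} ∪ {x | ε / 3 ≤ edist (W j x) (v x)} := by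
    intro x hx
    by_contra hcon
    simp only [mem_union, mem_ofPred_eq, not_or, not_le] at hcon hx
    obtain ⟨⟨hxu, hxUW⟩, hxv⟩ := hcon
    rw [edist_comm] at hxu
    have hlt := ENNReal.add_lt_add (ENNReal.add_lt_add hxu hxUW) hxv
    rw [ENNReal.add_thirds] at hlt
    exact hlt.not_ge (hx.trans (edist_triangle4 _ _ _ _))
  calc μ {x | ε ≤ edist (u i x) (v x)} ≤ η / 3 + η / 3 + η / 3 :=
        (measure_mono hsub).trans ((measure_union_le _ _).trans
          (add_le_add ((measure_union_le _ _).trans (add_le_add (hu i) hi.le)) hv))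
    _ = η := ENNReal.add_thirds η

section Sobolev

variable {n : ℕ} {Ω : Set (Space n)} {f : Space n → Space n} {p : ℝ}
  {fk : ℕ → Space n → Space n}

lemma WeakConv.tendsto_mollify (h : WeakConv Ω p fk f) (hΩ : MeasurableSet Ω) (hp : 1 < p)
    (j : ℕ) (x : Space n) :
    Tendsto (fun k => mollify j (Ω.indicator (fk k)) x) atTop
      (𝓝 (mollify j (Ω.indicator f) x)) := by
  simp only [mollify_indicator hΩ]
  exact h.tendsto _ (Real.HolderConjugate.conjExponent hp) _
    ((memLp_mollifier_sub j x _).restrict Ω)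

lemma exists_forall_measure_le_edist_mollify_le (hΩ : IsOpen Ω) (hfin : volume Ω ≠ ⊤) (hp : 1 ≤ p)
    {K ε η : ℝ≥0∞} (hK : K ≠ ⊤) (hε : ε ≠ 0) (hε' : ε ≠ ⊤) (hη : 0 < η) :
    ∃ j, ∀ g : Space n → Space n, MemSobolev Ω p g → ∫⁻ x in Ω, ‖weakDeriv Ω g x‖ₑ ≤ K →
      volume.restrict Ω {x | ε ≤ edist (mollify j (Ω.indicator g) x) (g x)} ≤ η := by
  set c : ℝ≥0∞ := 4 * 8 ^ Module.finrank ℝ (Space n) * K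
  have hc : c ≠ ⊤ :=
    ENNReal.mul_ne_top (ENNReal.mul_ne_top (by norm_num) (ENNReal.pow_ne_top (by norm_num))) hK
  have hlim : Tendsto (fun j : ℕ =>
      volume.restrict Ω (Metric.cthickening (2 * (1 / 2) ^ j) Ωᶜ) + c * 2⁻¹ ^ j / ε)
      atTop (𝓝 0) := by
    simpa only [mul_zero, zero_add, ENNReal.zero_div] using
      (tendsto_measure_restrict_cthickening_compl hΩ hfin).add (ENNReal.Tendsto.div_const
        (ENNReal.Tendsto.const_mul (ENNReal.tendsto_pow_atTop_nhds_zero_of_lt_one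
          ENNReal.one_half_lt_one) (Or.inr hc)) (Or.inr hε))
  obtain ⟨j, hj⟩ := (hlim.eventually (gt_mem_nhds hη)).exists
  refine ⟨j, fun g hg hgK => ?_⟩
  have hK' : ∫⁻ x, ‖Ω.indicator (weakDeriv Ω g) x‖ₑ ≤ K := by
    rw [← lintegral_indicator hΩ.measurableSet] at hgK
    refine (lintegral_congr fun x => ?_).trans_le hgK
    by_cases hx : x ∈ Ω
    · rw [indicator_of_mem hx, indicator_of_mem hx]
    · simp only [indicator_of_notMem hx]
      exact enorm_zero (E := Space n →L[ℝ] Space n)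
  calc volume.restrict Ω {x | ε ≤ edist (mollify j (Ω.indicator g) x) (g x)}
      = volume.restrict Ω {x | ε ≤ edist (mollify j (Ω.indicator g) x) (Ω.indicator g x)} := by
        refine measure_congr ?_
        filter_upwards [ae_restrict_mem hΩ.measurableSet] with x hx
        change (ε ≤ edist _ _) = (ε ≤ edist _ _)
        rw [indicator_of_mem hx]
    _ ≤ _ := (hg.hasMollifiedFDeriv hΩ hp hfin).measure_le_edist_mollify_le j hε hε'
    _ ≤ volume.restrict Ω (Metric.cthickening (2 * (1 / 2) ^ j) Ωᶜ) + c * 2⁻¹ ^ j / ε := by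
        gcongr
        exact mul_le_mul_right hK' _
    _ ≤ η := hj.le

theorem WeakConv.tendstoInMeasure (h : WeakConv Ω p fk f) (hΩ : IsOpen Ω) (hfin : volume Ω ≠ ⊤)
    (hp : 1 < p) {K : ℝ≥0∞} (hK : K ≠ ⊤) (hb : ∀ k, ∫⁻ x in Ω, ‖weakDeriv Ω (fk k) x‖ₑ ≤ K) :
    TendstoInMeasure (volume.restrict Ω) fk atTop f := by
  have : IsFiniteMeasure (volume.restrict Ω) := isFiniteMeasure_restrict.2 hfin
  have hK' : max K (∫⁻ x in Ω, ‖weakDeriv Ω f x‖ₑ) ≠ ⊤ :=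
    (max_lt hK.lt_top (h.mem_lim.integrableOn_weakDeriv hΩ hp.le hfin).2).ne
  refine tendstoInMeasure_of_forall_exists_approx
    (U := fun j k => mollify j (Ω.indicator (fk k))) (W := fun j => mollify j (Ω.indicator f))
    (fun j => tendstoInMeasure_of_tendsto_ae
      (fun k => (continuous_mollify j
        ((h.mem k).hasMollifiedFDeriv hΩ hp.le hfin).locInt).aestronglyMeasurable)
      (Eventually.of_forall fun x => h.tendsto_mollify hΩ.measurableSet hp j x))
    fun ε hε hεtop η hη => ?_
  obtain ⟨j, hj⟩ := exists_forall_measure_le_edist_mollify_le hΩ hfin hp.le hK' hε.ne' hεtop hη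
  exact ⟨j, fun k => hj _ (h.mem k) ((hb k).trans (le_max_left _ _)),
    hj _ h.mem_lim (le_max_right _ _)⟩

end Sobolev

/-! ### Compactness of sets of bounded perimeter -/

section MollifyIntegral

variable {V : Type*} [NormedAddCommGroup V] [InnerProductSpace ℝ V] [FiniteDimensional ℝ V]
  [MeasurableSpace V] [BorelSpace V]

lemma integrable_mollifier (j : ℕ) : Integrable (mollifier V j) :=
  (continuous_mollifier j).integrable_of_hasCompactSupport (hasCompactSupport_mollifier j)

lemma norm_mollify_le {E : Type*} [NormedAddCommGroup E] [NormedSpace ℝ E] {g : V → E} {c : ℝ}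
    (hg : ∀ x, ‖g x‖ ≤ c) (j : ℕ) (x : V) : ‖mollify j g x‖ ≤ c := by
  have hint : Integrable fun t => mollifier V j (x - t) := (integrable_mollifier j).comp_sub_left x
  rw [mollify_apply, ← one_mul c, ← integral_mollifier_sub j x, ← integral_mul_const]
  refine norm_integral_le_of_norm_le (hint.mul_const c) (.of_forall fun t => ?_)
  rw [norm_smul, Real.norm_of_nonneg (mollifier_nonneg _ _)]
  exact mul_le_mul_of_nonneg_left (hg t) (mollifier_nonneg _ _)

lemma mollify_nonneg {g : V → ℝ} (hg : ∀ x, 0 ≤ g x) (j : ℕ) (x : V) : 0 ≤ mollify j g x := by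
  rw [mollify_apply]
  exact integral_nonneg fun t => smul_nonneg (mollifier_nonneg _ _) (hg t)

lemma integral_mollify (j : ℕ) {g : V → ℝ} (hg : Integrable g) :
    ∫ x, mollify j g x = ∫ x, g x := by
  rw [mollify, integral_convolution _ (integrable_mollifier j) hg, integral_mollifier]
  simp

variable {μ : Measure V} [IsFiniteMeasure μ]

lemma tendsto_integral_mollify (hμ : μ ≪ volume) {E : Type*} [NormedAddCommGroup E]
    [NormedSpace ℝ E] [CompleteSpace E] {g : V → E} (hg : LocallyIntegrable g) {c : ℝ}
    (hc : ∀ x, ‖g x‖ ≤ c) :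
    Tendsto (fun m => ∫ x, mollify m g x ∂μ) atTop (𝓝 (∫ x, g x ∂μ)) :=
  tendsto_integral_of_dominated_convergence (fun _ => c)
    (fun m => (continuous_mollify m hg).aestronglyMeasurable) (integrable_const _)
    (fun m => .of_forall (norm_mollify_le hc m)) (hμ.ae_le (ae_tendsto_mollify hg))

lemma le_integral_mollify {g : V → ℝ} (hg : Continuous g) {c : ℝ} (hc : ∀ x, ‖g x‖ ≤ c) {j : ℕ}
    {b : ℝ} (hb : ∀ t, ‖t‖ ≤ (1 / 2) ^ j → b ≤ ∫ x, g (x - t) ∂μ) :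
    b ≤ ∫ x, mollify j g x ∂μ := by
  have hint : Integrable (fun q : V × V => mollifier V j q.2 * g (q.1 - q.2))
      (μ.prod volume) := by
    refine Integrable.mono' ((integrable_const c).mul_prod (integrable_mollifier j))
      (((continuous_mollifier j).comp continuous_snd).mul
        (hg.comp (continuous_fst.sub continuous_snd))).aestronglyMeasurable (.of_forall fun q => ?_)
    rw [norm_mul, Real.norm_of_nonneg (mollifier_nonneg _ _), mul_comm]
    exact mul_le_mul_of_nonneg_right (hc _) (mollifier_nonneg _ _)
  have hswap : ∫ x, mollify j g x ∂μ = ∫ t, mollifier V j t * ∫ x, g (x - t) ∂μ := by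
    have := integral_integral_swap (f := fun x t => mollifier V j t * g (x - t)) hint
    simp_rw [integral_const_mul] at this
    exact this
  have hint' : Integrable fun t => mollifier V j t * ∫ x, g (x - t) ∂μ := by
    simpa only [integral_const_mul] using hint.integral_prod_right
  rw [hswap, ← one_mul b, ← integral_mollifier (V := V) j, ← integral_mul_const]
  refine integral_mono ((integrable_mollifier j).mul_const b) hint' fun t => ?_
  by_cases ht : t ∈ Function.support (mollifier V j)
  · rw [support_mollifier, mem_ball_zero_iff] at ht
    exact mul_le_mul_of_nonneg_left (hb t ht.le) (mollifier_nonneg _ _)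
  · simp [Function.notMem_support.1 ht]

end MollifyIntegral

lemma hasDerivAt_integral_comp_sub_smul {V : Type*} [NormedAddCommGroup V]
    [NormedSpace ℝ V] [MeasurableSpace V] [OpensMeasurableSpace V] {μ : Measure V}
    [IsFiniteMeasure μ] {g : V → ℝ} (hg : ContDiff ℝ 1 g) (hc : HasCompactSupport g) (h : V)
    (t : ℝ) :
    HasDerivAt (fun t : ℝ => ∫ x, g (x - t • h) ∂μ) (-∫ x, fderiv ℝ g (x - t • h) h ∂μ) t := by
  have hDc : Continuous (fderiv ℝ g) := hg.continuous_fderiv one_ne_zero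
  obtain ⟨M, hM⟩ := (hc.fderiv ℝ).exists_bound_of_continuous hDc
  obtain ⟨M₀, hM₀⟩ := hc.exists_bound_of_continuous hg.continuous
  have hsub : ∀ t : ℝ, Continuous fun x : V => x - t • h := fun t => by fun_prop
  have hmeas : ∀ t : ℝ, AEStronglyMeasurable (fun x => g (x - t • h)) μ := fun t =>
    (hg.continuous.comp (hsub t)).aestronglyMeasurable
  rw [← integral_neg]
  refine (hasDerivAt_integral_of_dominated_loc_of_deriv_le
    (F' := fun t x => -fderiv ℝ g (x - t • h) h) (bound := fun _ => M * ‖h‖) univ_mem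
    (.of_forall hmeas) (.of_bound (hmeas t) M₀ (.of_forall fun x => hM₀ _))
    ((hDc.comp (hsub t)).clm_apply continuous_const).neg.aestronglyMeasurable
    (.of_forall fun x s _ => ?_) (integrable_const _) (.of_forall fun x s _ => ?_)).2
  · rw [norm_neg]
    exact (fderiv ℝ g _).le_of_opNorm_le (hM _) h
  · have hline : HasDerivAt (fun s : ℝ => x - s • h) (-h) s := by
      simpa using ((hasDerivAt_id s).smul_const h).const_sub x
    have hcomp :=
      ((hg.differentiable one_ne_zero) (x - s • h)).hasFDerivAt.comp_hasDerivAt s hline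
    rwa [map_neg] at hcomp

section Perimeter

variable {n : ℕ} {A : Set (Space n)}

lemma divergence_smul_const {g : Space n → ℝ} {x : Space n} (hg : DifferentiableAt ℝ g x)
    (h : Space n) : divergence (fun y => g y • h) x = fderiv ℝ g x h := by
  have hsum : h = ∑ i, h i • EuclideanSpace.single i (1 : ℝ) := by
    ext j
    simp [Pi.single_apply]
  rw [divergence, (hg.hasFDerivAt.smul_const h).fderiv]
  conv_rhs => rw [hsum, map_sum]
  simp [mul_comm]

lemma setIntegral_fderiv_le_perimeter (hP : perimeter A ≠ ⊤) {g : Space n → ℝ}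
    (hg : ContDiff ℝ 1 g) (hc : HasCompactSupport g) (hb : ∀ x, ‖g x‖ ≤ 1) (h : Space n) :
    ∫ x in A, fderiv ℝ g x h ≤ ‖h‖ * (perimeter A).toReal := by
  rcases eq_or_ne h 0 with rfl | hne
  · simp
  have hn : 0 < ‖h‖ := norm_pos_iff.2 hne
  have hdiv : ENNReal.ofReal (∫ x in A, divergence (fun y => g y • (‖h‖⁻¹ • h)) x)
      ≤ perimeter A := by
    refine le_iSup₂_of_le (fun y => g y • (‖h‖⁻¹ • h)) (hg.smul contDiff_const)
      (le_iSup₂_of_le hc.smul_right (fun x => ?_) le_rfl)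
    rw [norm_smul, norm_smul, norm_inv, norm_norm, inv_mul_cancel₀ hn.ne', mul_one]
    exact hb x
  simp_rw [ENNReal.ofReal_le_iff_le_toReal hP,
    divergence_smul_const (hg.differentiable one_ne_zero _), map_smul, smul_eq_mul,
    integral_const_mul, inv_mul_le_iff₀ hn] at hdiv
  exact hdiv

lemma setIntegral_comp_sub_ge (hA : volume A ≠ ⊤) (hP : perimeter A ≠ ⊤) {g : Space n → ℝ}
    (hg : ContDiff ℝ 1 g) (hc : HasCompactSupport g) (hb : ∀ x, ‖g x‖ ≤ 1) (h : Space n) :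
    (∫ x in A, g x) - ‖h‖ * (perimeter A).toReal ≤ ∫ x in A, g (x - h) := by
  have : IsFiniteMeasure (volume.restrict A) := isFiniteMeasure_restrict.2 hA
  have hderiv := hasDerivAt_integral_comp_sub_smul (μ := volume.restrict A) hg hc h
  have hshift : ∀ (t : ℝ) x, fderiv ℝ (fun y => g (y - t • h)) x = fderiv ℝ g (x - t • h) :=
    fun t x => by
      simpa [sub_eq_add_neg] using fderiv_comp_add_right (f := g) (x := x) (-(t • h))
  have hle : ∀ t : ℝ, -(‖h‖ * (perimeter A).toReal) ≤
      deriv (fun t : ℝ => ∫ x in A, g (x - t • h)) t := fun t => by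
    rw [(hderiv t).deriv, neg_le_neg_iff]
    simpa only [hshift] using setIntegral_fderiv_le_perimeter hP
      (g := fun y => g (y - t • h)) (hg.comp (contDiff_id.sub contDiff_const))
      (hc.comp_homeomorph (Homeomorph.subRight (t • h))) (fun x => hb _) h
  have hmvt := mul_sub_le_image_sub_of_le_deriv (fun t => (hderiv t).differentiableAt) hle
    zero_le_one
  simp only [sub_zero, mul_one, one_smul, zero_smul] at hmvt
  linarith

lemma setIntegral_mollify_ge (hA : volume A ≠ ⊤) (hP : perimeter A ≠ ⊤) {g : Space n → ℝ}
    (hg : ContDiff ℝ 1 g) (hc : HasCompactSupport g) (hb : ∀ x, ‖g x‖ ≤ 1) (j : ℕ) :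
    (∫ x in A, g x) - (1 / 2) ^ j * (perimeter A).toReal ≤ ∫ x in A, mollify j g x := by
  have : IsFiniteMeasure (volume.restrict A) := isFiniteMeasure_restrict.2 hA
  refine le_integral_mollify hg.continuous hb fun t ht => ?_
  refine le_trans ?_ (setIntegral_comp_sub_ge hA hP hg hc hb t)
  gcongr

lemma norm_indicator_one_le (A : Set (Space n)) (x : Space n) :
    ‖A.indicator (1 : Space n → ℝ) x‖ ≤ 1 :=
  (norm_indicator_le_norm_self _ _).trans_eq (by simp)

lemma integrable_indicator_one (hA : MeasurableSet A) (hAv : volume A ≠ ⊤) :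
    Integrable (A.indicator (1 : Space n → ℝ)) :=
  (integrableOn_const hAv (C := (1 : ℝ))).integrable_indicator hA

lemma setIntegral_mollify_indicator_ge (hA : MeasurableSet A) (hAb : Bornology.IsBounded A)
    (hP : perimeter A ≠ ⊤) (j : ℕ) :
    volume.real A - (1 / 2) ^ j * (perimeter A).toReal ≤
      ∫ x in A, mollify j (A.indicator (1 : Space n → ℝ)) x := by
  have hAv : volume A ≠ ⊤ := hAb.measure_lt_top.ne
  have : IsFiniteMeasure (volume.restrict A) := isFiniteMeasure_restrict.2 hAv
  set χ : Space n → ℝ := A.indicator 1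
  have hχ : LocallyIntegrable χ := (integrable_indicator_one hA hAv).locallyIntegrable
  have hχc : HasCompactSupport χ := hAb.isCompact_closure.of_isClosed_subset isClosed_closure
    (closure_mono support_indicator_subset)
  have hχA : ∫ x in A, χ x = volume.real A := by
    rw [setIntegral_indicator hA, inter_self]
    simp
  have hsmooth : ∀ m, (∫ x in A, mollify m χ x) - (1 / 2) ^ j * (perimeter A).toReal
      ≤ ∫ x in A, mollify m (mollify j χ) x := fun m => by
    rw [mollify_comm m j hχ]
    refine setIntegral_mollify_ge hAv hP ?_ ((hasCompactSupport_mollifier m).convolution _ hχc)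
      (norm_mollify_le (norm_indicator_one_le A) m) j
    exact_mod_cast (hasCompactSupport_mollifier m).contDiff_convolution_left (n := 1)
      (ContinuousLinearMap.lsmul ℝ ℝ) ((contDiff_mollifier m).of_le (by norm_cast)) hχ
  have hχ₁ := tendsto_integral_mollify (μ := volume.restrict A)
    Measure.restrict_le_self.absolutelyContinuous hχ (norm_indicator_one_le A)
  have hχ₂ := tendsto_integral_mollify (μ := volume.restrict A)
    Measure.restrict_le_self.absolutelyContinuous (continuous_mollify j hχ).locallyIntegrable
    (norm_mollify_le (norm_indicator_one_le A) j)
  rw [hχA] at hχ₁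
  exact le_of_tendsto_of_tendsto' (hχ₁.sub_const _) hχ₂ hsmooth

lemma integral_norm_mollify_indicator_sub_le (hA : MeasurableSet A) (hAb : Bornology.IsBounded A)
    (hP : perimeter A ≠ ⊤) (j : ℕ) :
    ∫ x, ‖mollify j (A.indicator 1) x - A.indicator (1 : Space n → ℝ) x‖ ≤
      2 * (1 / 2) ^ j * (perimeter A).toReal := by
  set χ : Space n → ℝ := A.indicator 1
  have hχ : Integrable χ := integrable_indicator_one hA hAb.measure_lt_top.ne
  have hmχ : Integrable (mollify j χ) := (integrable_mollifier j).integrable_convolution _ hχ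
  have hnonneg := mollify_nonneg (g := χ) (indicator_nonneg fun _ _ => zero_le_one) j
  have hle := fun x => (le_abs_self _).trans (norm_mollify_le (norm_indicator_one_le A) j x)
  have hpt : ∀ x, ‖mollify j χ x - χ x‖ =
      mollify j χ x + χ x - 2 * A.indicator (mollify j χ) x := fun x => by
    by_cases hx : x ∈ A
    · simp only [χ, indicator_of_mem hx, Pi.one_apply, Real.norm_eq_abs]
      rw [abs_of_nonpos (sub_nonpos.2 (hle x))]
      ring
    · simp [χ, indicator_of_notMem hx, hnonneg]
  have hχv : ∫ x, χ x = volume.real A := integral_indicator_one hA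
  have hadd : Integrable fun x => mollify j χ x + χ x := hmχ.add hχ
  simp_rw [hpt]
  rw [integral_sub hadd ((hmχ.indicator hA).const_mul 2), integral_add hmχ hχ,
    integral_mollify j hχ, hχv, integral_const_mul, integral_indicator hA]
  linarith [setIntegral_mollify_indicator_ge hA hAb hP j]

lemma lintegral_edist_mollify_indicator_le (hA : MeasurableSet A) (hAb : Bornology.IsBounded A)
    (j : ℕ) : ∫⁻ x, edist (mollify j (A.indicator 1) x) (A.indicator (1 : Space n → ℝ) x) ≤
      2 * 2⁻¹ ^ j * perimeter A := by
  rcases eq_or_ne (perimeter A) ⊤ with hP | hP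
  · rw [hP, ENNReal.mul_top (by simp)]
    exact le_top
  have hχ : Integrable (A.indicator (1 : Space n → ℝ)) :=
    integrable_indicator_one hA hAb.measure_lt_top.ne
  have hmχ : Integrable fun x => mollify j (A.indicator 1) x - A.indicator (1 : Space n → ℝ) x :=
    ((integrable_mollifier j).integrable_convolution _ hχ).sub hχ
  have hhalf : ENNReal.ofReal (1 / 2) = 2⁻¹ := by
    rw [one_div, ENNReal.ofReal_inv_of_pos two_pos, ENNReal.ofReal_ofNat]
  simp_rw [edist_eq_enorm_sub]
  rw [← ofReal_integral_norm_eq_lintegral_enorm hmχ]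
  refine (ENNReal.ofReal_le_ofReal
    (integral_norm_mollify_indicator_sub_le hA hAb hP j)).trans_eq ?_
  rw [ENNReal.ofReal_mul (by positivity), ENNReal.ofReal_mul two_pos.le,
    ENNReal.ofReal_pow (by positivity), hhalf, ENNReal.ofReal_toReal hP, ENNReal.ofReal_ofNat]

end Perimeter

section WeakCompactness

lemma exists_subseq_forall_tendsto_inner {H : Type*} [NormedAddCommGroup H]
    [InnerProductSpace ℝ H] [CompleteSpace H] [TopologicalSpace.SeparableSpace H] {e : ℕ → H}
    {r : ℝ} (he : ∀ k, ‖e k‖ ≤ r) :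
    ∃ (w : H) (σ : ℕ → ℕ), StrictMono σ ∧
      ∀ v, Tendsto (fun k => inner ℝ (e (σ k)) v) atTop (𝓝 (inner ℝ w v)) := by
  have hmem : ∀ k, StrongDual.toWeakDual (innerSL ℝ (e k)) ∈
      WeakDual.toStrongDual ⁻¹' Metric.closedBall (0 : StrongDual ℝ H) r := fun k => by
    rw [mem_preimage, mem_closedBall_zero_iff]
    exact (innerSL_apply_norm ℝ (e k)).trans_le (he k)
  obtain ⟨T, -, σ, hσ, hlim⟩ := WeakDual.isSeqCompact_closedBall ℝ H 0 r hmem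
  refine ⟨(InnerProductSpace.toDual ℝ H).symm (WeakDual.toStrongDual T), σ, hσ, fun v => ?_⟩
  rw [InnerProductSpace.toDual_symm_apply]
  exact ((WeakDual.eval_continuous v).tendsto T).comp hlim

lemma exists_subseq_forall_tendsto_setIntegral {X : Type*} [MeasurableSpace X] {μ : Measure X}
    [TopologicalSpace.SeparableSpace (Lp ℝ 2 μ)] {A : ℕ → Set X} (hA : ∀ k, MeasurableSet (A k))
    {M : ℝ≥0∞} (hM : M ≠ ⊤) (hAM : ∀ k, μ (A k) ≤ M) :
    ∃ w : X → ℝ, MemLp w 2 μ ∧ ∃ σ : ℕ → ℕ, StrictMono σ ∧ ∀ g : X → ℝ, MemLp g 2 μ →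
      Tendsto (fun k => ∫ x in A (σ k), g x ∂μ) atTop (𝓝 (∫ x, w x * g x ∂μ)) := by
  have hfin : ∀ k, μ (A k) ≠ ⊤ := fun k => ((hAM k).trans_lt hM.lt_top).ne
  have hbound : ∀ k, ‖indicatorConstLp 2 (hA k) (hfin k) (1 : ℝ)‖ ≤
      M.toReal ^ (1 / (2 : ℝ≥0∞).toReal) := fun k => by
    refine norm_indicatorConstLp_le.trans ?_
    rw [norm_one, one_mul]
    exact Real.rpow_le_rpow measureReal_nonneg (ENNReal.toReal_mono hM (hAM k)) (by positivity)
  obtain ⟨w, σ, hσ, hw⟩ := exists_subseq_forall_tendsto_inner hbound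
  refine ⟨w, Lp.memLp w, σ, hσ, fun g hg => ?_⟩
  have hlim : inner ℝ w (hg.toLp g) = ∫ x, w x * g x ∂μ := by
    rw [L2.inner_def]
    refine integral_congr_ae (hg.coeFn_toLp.mono fun x hx => ?_)
    simp only [hx]
    exact mul_comm _ _
  rw [← hlim]
  refine (hw (hg.toLp g)).congr fun k => ?_
  rw [L2.inner_indicatorConstLp_one]
  exact integral_congr_ae (ae_restrict_of_ae hg.coeFn_toLp)

end WeakCompactness

lemma tendsto_measure_symmDiff_of_tendstoInMeasure {X ι : Type*} [MeasurableSpace X]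
    {μ : Measure X} {l : Filter ι} {A : ι → Set X} {w : X → ℝ}
    (h : TendstoInMeasure μ (fun i => (A i).indicator 1) l w) :
    Tendsto (fun i => μ (A i ∆ {x | 1 / 2 < w x})) l (𝓝 0) := by
  refine tendsto_of_tendsto_of_tendsto_of_le_of_le tendsto_const_nhds
    (h (ENNReal.ofReal (1 / 2)) (by simp)) (fun _ => zero_le) fun i => measure_mono fun x hx => ?_
  rw [mem_ofPred_eq, edist_dist, Real.dist_eq]
  refine ENNReal.ofReal_le_ofReal ?_
  rcases hx with ⟨hxA, hxw⟩ | ⟨hxw, hxA⟩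
  · have hwx : w x ≤ 1 / 2 := not_lt.1 hxw
    simp only [indicator_of_mem hxA, Pi.one_apply]
    linarith [le_abs_self (1 - w x)]
  · have hwx : 1 / 2 < w x := hxw
    simp only [indicator_of_notMem hxA]
    linarith [neg_le_abs (0 - w x)]

section SetCompactness

variable {n : ℕ} {D : Set (Space n)} {A : ℕ → Set (Space n)} {P : ℝ≥0∞}

lemma tendstoInMeasure_indicator_one {w : Space n → ℝ} (hDb : Bornology.IsBounded D)
    (hA : ∀ k, MeasurableSet (A k)) (hAD : ∀ k, A k ⊆ D) (hP : P ≠ ⊤)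
    (hAP : ∀ k, perimeter (A k) ≤ P) (hw : MemLp w 2)
    (hlim : ∀ g : Space n → ℝ, MemLp g 2 →
      Tendsto (fun k => ∫ x in A k, g x) atTop (𝓝 (∫ x, w x * g x))) :
    TendstoInMeasure (volume.restrict D) (fun k => (A k).indicator 1) atTop w := by
  have : IsFiniteMeasure (volume.restrict D) := isFiniteMeasure_restrict.2 hDb.measure_lt_top.ne
  have hAb : ∀ k, Bornology.IsBounded (A k) := fun k => hDb.subset (hAD k)
  have hw' : LocallyIntegrable w := hw.locallyIntegrable (by norm_num)
  have hconv : ∀ j x, Tendsto (fun k => mollify j ((A k).indicator (1 : Space n → ℝ)) x) atTop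
      (𝓝 (mollify j w x)) := fun j x => by
    simp_rw [mollify_indicator (hA _), mollify_apply, smul_eq_mul, Pi.one_apply, mul_one]
    simpa only [mul_comm] using hlim _ (memLp_mollifier_sub j x 2)
  have hmeas : ∀ j k, AEStronglyMeasurable (mollify j ((A k).indicator (1 : Space n → ℝ)))
      (volume.restrict D) := fun j k => (continuous_mollify j (integrable_indicator_one (hA k)
    (hAb k).measure_lt_top.ne).locallyIntegrable).aestronglyMeasurable
  refine tendstoInMeasure_of_forall_exists_approx
    (U := fun j k => mollify j ((A k).indicator 1)) (W := fun j => mollify j w)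
    (fun j => tendstoInMeasure_of_tendsto_ae (hmeas j) (.of_forall (hconv j)))
    fun ε hε hεtop η hη => ?_
  have hsmall : Tendsto (fun j : ℕ => 2 * 2⁻¹ ^ j * P / ε) atTop (𝓝 0) := by
    have hpow : Tendsto (fun j : ℕ => (2⁻¹ : ℝ≥0∞) ^ j) atTop (𝓝 0) :=
      ENNReal.tendsto_pow_atTop_nhds_zero_iff.2 ENNReal.one_half_lt_one
    simpa using ENNReal.Tendsto.div_const (ENNReal.Tendsto.mul_const
      (ENNReal.Tendsto.const_mul hpow (.inr ENNReal.ofNat_ne_top)) (.inr hP)) (.inr hε.ne')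
  have hmoll : TendstoInMeasure (volume.restrict D) (fun j => mollify j w) atTop w :=
    tendstoInMeasure_of_tendsto_ae (fun j => (continuous_mollify j hw').aestronglyMeasurable)
      (ae_restrict_of_ae (ae_tendsto_mollify hw'))
  obtain ⟨j, hj, hjw⟩ :=
    ((hsmall.eventually (gt_mem_nhds hη)).and ((hmoll ε hε).eventually (gt_mem_nhds hη))).exists
  refine ⟨j, fun k => ?_, hjw.le⟩
  refine (meas_ge_le_lintegral_div ?_ hε.ne' hεtop).trans (le_trans ?_ hj.le)
  · exact (hmeas j k).edist (aestronglyMeasurable_const.indicator (hA k))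
  · gcongr
    exact (setLIntegral_le_lintegral _ _).trans
      ((lintegral_edist_mollify_indicator_le (hA k) (hAb k) j).trans (by gcongr; exact hAP k))

theorem exists_subseq_tendstoInMeas (hD : MeasurableSet D) (hDb : Bornology.IsBounded D)
    (hA : ∀ k, MeasurableSet (A k)) (hAD : ∀ k, A k ⊆ D) (hP : P ≠ ⊤)
    (hAP : ∀ k, perimeter (A k) ≤ P) :
    ∃ σ : ℕ → ℕ, StrictMono σ ∧ ∃ B, NullMeasurableSet B volume ∧
      TendstoInMeas (fun k => A (σ k)) B := by
  have : Fact ((2 : ℝ≥0∞) ≠ ⊤) := ⟨by norm_num⟩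
  obtain ⟨w, hw, σ, hσ, hlim⟩ := exists_subseq_forall_tendsto_setIntegral (μ := volume) hA
    hDb.measure_lt_top.ne fun k => measure_mono (hAD k)
  have hsymm := tendsto_measure_symmDiff_of_tendstoInMeasure (tendstoInMeasure_indicator_one hDb
    (fun k => hA (σ k)) (fun k => hAD (σ k)) hP (fun k => hAP (σ k)) hw hlim)
  refine ⟨σ, hσ, {x | 1 / 2 < w x} ∩ D, (nullMeasurableSet_lt aemeasurable_const
    hw.aestronglyMeasurable.aemeasurable).inter hD.nullMeasurableSet, hsymm.congr fun k => ?_⟩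
  rw [Measure.restrict_apply' hD, inter_symmDiff_distrib_right, inter_eq_left.2 (hAD _)]

end SetCompactness

/-! ### Limits of homeomorphisms with finitely many cavities -/

section Approximation

variable {n : ℕ} {Ω : Set (Space n)} {p : ℝ} {φ : ℝ → ℝ} {a C : ℝ} {f₀ f : Space n → Space n}

namespace HasCavitySet

variable {A : Set (Space n)}

lemma isClosed (h : HasCavitySet Ω p f₀ f A) : IsClosed A := by
  obtain ⟨m, x, K, -, hK, -, -, -, rfl⟩ := h.exists_cavities
  exact isClosed_iUnion_of_finite fun i => (hK i).2.2.1.isClosed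

lemma subset (h : HasCavitySet Ω p f₀ f A) : A ⊆ f₀ '' Ω := by
  obtain ⟨m, x, K, -, hK, -, -, -, rfl⟩ := h.exists_cavities
  exact iUnion_subset fun i => (hK i).1

end HasCavitySet

lemma lintegral_enorm_weakDeriv_le (hp : 1 ≤ p) :
    ∫⁻ x in Ω, ‖weakDeriv Ω f x‖ₑ ≤ volume Ω + energy Ω p φ f := by
  have hle : ∀ x, ‖weakDeriv Ω f x‖ₑ ≤
      1 + (‖weakDeriv Ω f x‖ₑ ^ p + extend φ (weakDeriv Ω f x).det) := fun x => by
    rcases le_total ‖weakDeriv Ω f x‖ₑ 1 with h | h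
    · exact h.trans le_self_add
    · exact (ENNReal.le_rpow_self_of_one_le h hp).trans (le_add_left le_self_add)
  refine (lintegral_mono hle).trans_eq ?_
  rw [lintegral_add_left measurable_const, setLIntegral_const, one_mul, energy]

namespace IsApproximation

variable {fk gk : ℕ → Space n → Space n} {Ak Bk : ℕ → Set (Space n)} {A B : Set (Space n)}

lemma comp (h : IsApproximation Ω p φ a f₀ C fk Ak f) {σ : ℕ → ℕ} (hσ : Tendsto σ atTop atTop) :
    IsApproximation Ω p φ a f₀ C (fun k => fk (σ k)) (fun k => Ak (σ k)) f where
  hasCavitySet k := h.hasCavitySet (σ k)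
  energy_le k := h.energy_le (σ k)
  weakConv :=
    { mem := fun k => h.weakConv.mem (σ k)
      mem_lim := h.weakConv.mem_lim
      tendsto := fun q hq g hg => (h.weakConv.tendsto q hq g hg).comp hσ
      tendsto_deriv := fun q hq g hg => (h.weakConv.tendsto_deriv q hq g hg).comp hσ }

lemma lintegral_extend_det_le (h : IsApproximation Ω p φ a f₀ C fk Ak f) (k : ℕ) :
    ∫⁻ x in Ω, extend φ (weakDeriv Ω (fk k) x).det ≤ ENNReal.ofReal C :=
  (lintegral_mono fun _ => le_add_self).trans (le_self_add.trans (h.energy_le k))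

lemma perimeter_le (h : IsApproximation Ω p φ a f₀ C fk Ak f) (ha : 0 < a) (k : ℕ) :
    perimeter (Ak k) ≤ ENNReal.ofReal C / ENNReal.ofReal a := by
  rw [ENNReal.le_div_iff_mul_le (.inl (ENNReal.ofReal_pos.2 ha).ne') (.inl ENNReal.ofReal_ne_top),
    mul_comm]
  exact le_add_self.trans (h.energy_le k)

lemma exists_subseq_tendsto_ae (h : IsApproximation Ω p φ a f₀ C fk Ak f) (hp : 1 < p)
    (hΩ : IsOpen Ω) (hfin : volume Ω ≠ ⊤) :
    ∃ σ : ℕ → ℕ, StrictMono σ ∧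
      ∀ᵐ x ∂volume.restrict Ω, Tendsto (fun k => fk (σ k) x) atTop (𝓝 (f x)) :=
  (h.weakConv.tendstoInMeasure hΩ hfin hp
    (ENNReal.add_ne_top.2 ⟨hfin, ENNReal.ofReal_ne_top⟩) fun k =>
      (lintegral_enorm_weakDeriv_le hp.le).trans
        (add_le_add_right (le_self_add.trans (h.energy_le k)) _)).exists_seq_tendsto_ae

theorem exists_subseq_tendstoInMeas (h : IsApproximation Ω p φ a f₀ C fk Ak f) (ha : 0 < a)
    (hf₀ : Bornology.IsBounded (f₀ '' Ω)) :
    ∃ σ : ℕ → ℕ, StrictMono σ ∧ ∃ B, NullMeasurableSet B volume ∧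
      TendstoInMeas (fun k => Ak (σ k)) B :=
  Cavitation.exists_subseq_tendstoInMeas isClosed_closure.measurableSet hf₀.closure
    (fun k => (h.hasCavitySet k).isClosed.measurableSet)
    (fun k => (h.hasCavitySet k).subset.trans subset_closure)
    (ENNReal.div_ne_top ENNReal.ofReal_ne_top (ENNReal.ofReal_pos.2 ha).ne') (h.perimeter_le ha)

lemma measure_sdiff_eq_zero (h : IsApproximation Ω p φ a f₀ C fk Ak f)
    (hB : TendstoInMeas Ak B) : volume (B \ closure (f₀ '' Ω)) = 0 :=
  nonpos_iff_eq_zero.1 (ge_of_tendsto' hB fun k => measure_mono fun _ hx =>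
    .inr ⟨hx.1, fun hxA => hx.2 (subset_closure ((h.hasCavitySet k).subset hxA))⟩)

lemma tendsto_restrict_measure_symmDiff (hB : TendstoInMeas Ak B) (D : Set (Space n)) :
    Tendsto (fun k => volume.restrict D (Ak k ∆ B)) atTop (𝓝 0) :=
  tendsto_of_tendsto_of_tendsto_of_le_of_le tendsto_const_nhds hB (fun _ => zero_le)
    fun _ => Measure.restrict_apply_le _ _

section Transport

variable [Nontrivial (Space n)]

lemma map_withDensity_abs_det (h : IsApproximation Ω p φ a f₀ C fk Ak f) (hp : 1 ≤ p)
    (hΩ : IsOpen Ω) (hfin : volume Ω ≠ ⊤) (hbd : volume (f₀ '' frontier Ω) = 0) (k : ℕ) :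
    ((volume.restrict Ω).withDensity fun x =>
        ENNReal.ofReal |(weakDeriv Ω (fk k) x).det|).map (fk k) =
      (volume.restrict (closure (f₀ '' Ω))).restrict (Ak k)ᶜ := by
  rw [(h.hasCavitySet k).map_withDensity_abs_det hp hΩ hfin hbd, sdiff_eq, inter_comm,
    Measure.restrict_restrict (h.hasCavitySet k).isClosed.measurableSet.compl]

lemma map_absolutelyContinuous (h : IsApproximation Ω p φ a f₀ C fk Ak f) (hp : 1 < p)
    (hφ : Tendsto φ (𝓝[>] 0) atTop) (hΩ : IsOpen Ω) (hfin : volume Ω ≠ ⊤)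
    (hf₀ : Bornology.IsBounded (f₀ '' Ω)) (hbd : volume (f₀ '' frontier Ω) = 0)
    (hB : TendstoInMeas Ak B) :
    (volume.restrict Ω).map f ≪ (volume.restrict (closure (f₀ '' Ω))).restrict Bᶜ := by
  obtain ⟨σ, hσ, hlim⟩ := h.exists_subseq_tendsto_ae hp hΩ hfin
  have : IsFiniteMeasure (volume.restrict (closure (f₀ '' Ω))) :=
    isFiniteMeasure_restrict.2 hf₀.closure.measure_lt_top.ne
  have hdet : ∀ k, AEMeasurable (fun x => (weakDeriv Ω (fk k) x).det) (volume.restrict Ω) :=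
    fun k => (ContinuousLinearMap.continuous_det.comp_aestronglyMeasurable
      ((h.weakConv.mem k).integrableOn_weakDeriv hΩ hp.le hfin).aestronglyMeasurable).aemeasurable
  exact map_absolutelyContinuous_restrict_compl
    (uniformlyAbsolutelyContinuous_withDensity_abs_right hφ ENNReal.ofReal_ne_top
      (fun k => hdet (σ k)) fun k => h.lintegral_extend_det_le (σ k))
    (fun k => ((h.hasCavitySet (σ k)).aemeasurable hΩ hbd).mono_ac
      (withDensity_absolutelyContinuous _ _))
    (fun k => h.map_withDensity_abs_det hp.le hΩ hfin hbd (σ k))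
    h.weakConv.mem_lim.1.aestronglyMeasurable.aemeasurable hlim
    ((tendsto_restrict_measure_symmDiff hB _).comp hσ.tendsto_atTop)

lemma absolutelyContinuous_map (h : IsApproximation Ω p φ a f₀ C fk Ak f) (hp : 1 < p)
    (hφ : Tendsto (fun t => φ t / t) atTop atTop) (hΩ : IsOpen Ω) (hfin : volume Ω ≠ ⊤)
    (hf₀ : Bornology.IsBounded (f₀ '' Ω)) (hbd : volume (f₀ '' frontier Ω) = 0)
    (hB : TendstoInMeas Ak B) :
    (volume.restrict (closure (f₀ '' Ω))).restrict Bᶜ ≪ (volume.restrict Ω).map f := by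
  obtain ⟨σ, hσ, hlim⟩ := h.exists_subseq_tendsto_ae hp hΩ hfin
  have : IsFiniteMeasure (volume.restrict Ω) := isFiniteMeasure_restrict.2 hfin
  have : IsFiniteMeasure (volume.restrict (closure (f₀ '' Ω))) :=
    isFiniteMeasure_restrict.2 hf₀.closure.measure_lt_top.ne
  exact restrict_compl_absolutelyContinuous_map
    (uniformlyAbsolutelyContinuous_withDensity_abs_left hφ ENNReal.ofReal_ne_top
      fun k => h.lintegral_extend_det_le (σ k))
    (fun k => (h.hasCavitySet (σ k)).aemeasurable hΩ hbd)
    (fun k => h.map_withDensity_abs_det hp.le hΩ hfin hbd (σ k))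
    h.weakConv.mem_lim.1.aestronglyMeasurable.aemeasurable hlim
    ((tendsto_restrict_measure_symmDiff hB _).comp hσ.tendsto_atTop)

lemma measure_limit_sdiff_limit (h : IsApproximation Ω p φ a f₀ C fk Ak f)
    (h' : IsApproximation Ω p φ a f₀ C gk Bk f) (hp : 1 < p)
    (hφ0 : Tendsto φ (𝓝[>] 0) atTop) (hφtop : Tendsto (fun t => φ t / t) atTop atTop)
    (hΩ : IsOpen Ω) (hfin : volume Ω ≠ ⊤) (hf₀ : Bornology.IsBounded (f₀ '' Ω))
    (hbd : volume (f₀ '' frontier Ω) = 0) (hAm : NullMeasurableSet A) (hA : TendstoInMeas Ak A)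
    (hB : TendstoInMeas Bk B) : volume (A \ B) = 0 := by
  have hnull := measure_sdiff_eq_zero_of_restrict_compl_absolutelyContinuous
    (hAm.mono_ac Measure.restrict_le_self.absolutelyContinuous)
    ((h'.absolutelyContinuous_map hp hφtop hΩ hfin hf₀ hbd hB).trans
      (h.map_absolutelyContinuous hp hφ0 hΩ hfin hf₀ hbd hA))
  rw [Measure.restrict_apply' isClosed_closure.measurableSet] at hnull
  refine measure_mono_null (fun x hx => ?_) (measure_union_null hnull (h.measure_sdiff_eq_zero hA))
  by_cases hxD : x ∈ closure (f₀ '' Ω)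
  · exact .inl ⟨hx, hxD⟩
  · exact .inr ⟨hx.1, hxD⟩

theorem measure_symmDiff_eq_zero (h : IsApproximation Ω p φ a f₀ C fk Ak f)
    (h' : IsApproximation Ω p φ a f₀ C gk Bk f) (hp : 1 < p)
    (hφ0 : Tendsto φ (𝓝[>] 0) atTop) (hφtop : Tendsto (fun t => φ t / t) atTop atTop)
    (hΩ : IsOpen Ω) (hfin : volume Ω ≠ ⊤) (hf₀ : Bornology.IsBounded (f₀ '' Ω))
    (hbd : volume (f₀ '' frontier Ω) = 0) (hAm : NullMeasurableSet A) (hBm : NullMeasurableSet B)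
    (hA : TendstoInMeas Ak A) (hB : TendstoInMeas Bk B) : volume (A ∆ B) = 0 :=
  measure_union_null
    (h.measure_limit_sdiff_limit h' hp hφ0 hφtop hΩ hfin hf₀ hbd hAm hA hB)
    (h'.measure_limit_sdiff_limit h hp hφ0 hφtop hΩ hfin hf₀ hbd hBm hB hA)

theorem tendstoInMeas (h : IsApproximation Ω p φ a f₀ C fk Ak f)
    (h' : IsApproximation Ω p φ a f₀ C gk Bk f) (hp : 1 < p)
    (hφ0 : Tendsto φ (𝓝[>] 0) atTop) (hφtop : Tendsto (fun t => φ t / t) atTop atTop)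
    (ha : 0 < a) (hΩ : IsOpen Ω) (hfin : volume Ω ≠ ⊤) (hf₀ : Bornology.IsBounded (f₀ '' Ω))
    (hbd : volume (f₀ '' frontier Ω) = 0) (hBm : NullMeasurableSet B) (hB : TendstoInMeas Bk B) :
    TendstoInMeas Ak B := by
  refine tendsto_of_subseq_tendsto fun σ hσ => ?_
  obtain ⟨τ, hτ, A, hAm, hA⟩ := (h.comp hσ).exists_subseq_tendstoInMeas ha hf₀
  have hAB := ((h.comp hσ).comp hτ.tendsto_atTop).measure_symmDiff_eq_zero h' hp hφ0 hφtop hΩ hfin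
    hf₀ hbd hAm hBm hA hB
  refine ⟨τ, tendsto_of_tendsto_of_tendsto_of_le_of_le tendsto_const_nhds hA (fun _ => zero_le)
    fun k => (measure_symmDiff_le _ A _).trans ?_⟩
  rw [hAB, add_zero]

end Transport

end IsApproximation

end Approximation

theorem theorem4p2_general {n : ℕ} [Nontrivial (Space n)] {p : ℝ} (hp : 1 < p) {φ : ℝ → ℝ}
    (hφ0 : Tendsto φ (𝓝[>] 0) atTop) (hφtop : Tendsto (fun t => φ t / t) atTop atTop) {a : ℝ}
    (ha : 0 < a) {Ω : Set (Space n)} (hΩ : IsOpen Ω) (hfin : volume Ω ≠ ⊤)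
    {f₀ : Space n → Space n} (hf₀ : Bornology.IsBounded (f₀ '' Ω))
    (hbd : volume (f₀ '' frontier Ω) = 0) (C : ℝ) :
    (∀ (f : Space n → Space n) (fk : ℕ → Space n → Space n) (Ak : ℕ → Set (Space n)),
      IsApproximation Ω p φ a f₀ C fk Ak f →
      ∀ σ τ : ℕ → ℕ, StrictMono σ → StrictMono τ →
      ∀ A₁ A₂ : Set (Space n), NullMeasurableSet A₁ volume → NullMeasurableSet A₂ volume →
        TendstoInMeas (fun l => Ak (σ l)) A₁ → TendstoInMeas (fun m => Ak (τ m)) A₂ →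
        volume (A₁ ∆ A₂) = 0) ∧
    (∀ f ∈ weakClosure Ω p φ a f₀ C,
      (∃ A, IsLimitCavitySet Ω p φ a f₀ C f A) ∧
      ∀ A A', IsLimitCavitySet Ω p φ a f₀ C f A → IsLimitCavitySet Ω p φ a f₀ C f A' →
        volume (A ∆ A') = 0) := by
  refine ⟨fun f fk Ak h σ τ hσ hτ A₁ A₂ hA₁ hA₂ h₁ h₂ =>
    (h.comp hσ.tendsto_atTop).measure_symmDiff_eq_zero (h.comp hτ.tendsto_atTop) hp hφ0 hφtop hΩ
      hfin hf₀ hbd hA₁ hA₂ h₁ h₂, ?_⟩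
  rintro f ⟨fk, Ak, h⟩
  refine ⟨?_, fun A A' hA hA' => h.measure_symmDiff_eq_zero h hp hφ0 hφtop hΩ hfin hf₀ hbd
    hA.1 hA'.1 (hA.2 fk Ak h) (hA'.2 fk Ak h)⟩
  obtain ⟨σ, hσ, A, hAm, hA⟩ := h.exists_subseq_tendstoInMeas ha hf₀
  exact ⟨A, hAm, fun gk Bk h' => h'.tendstoInMeas (h.comp hσ.tendsto_atTop) hp hφ0 hφtop ha hΩ hfin
    hf₀ hbd hAm hA⟩

lemma one_lt_of_natCast_div_two_lt {n : ℕ} (hn : 2 ≤ n) {p : ℝ} (hp : ((n / 2 : ℕ) : ℝ) < p) :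
    1 < p :=
  lt_of_le_of_lt (by exact_mod_cast (Nat.le_div_iff_mul_le two_pos).2 hn) hp

lemma isBounded_image_of_continuousOn_closure {X Y : Type*} [PseudoMetricSpace X] [ProperSpace X]
    [PseudoMetricSpace Y] {f : X → Y} {s : Set X} (hs : Bornology.IsBounded s)
    (hf : ContinuousOn f (closure s)) : Bornology.IsBounded (f '' s) :=
  (hs.isCompact_closure.image_of_continuousOn hf).isBounded.subset (image_mono subset_closure)

end Cavitation

/-- Any two subsequential limits in measure of the cavity sets `A(f_k)` of a weakly and a.e.
convergent sequence with bounded energy agree up to a null set; hence every weak limit map `f` has a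
cavity set `A(f)`, unique up to a null set. -/
theorem theorem4p2 {n : ℕ} (hn : 2 ≤ n) {p : ℝ} (hp : ((n / 2 : ℕ) : ℝ) < p)
    {φ : ℝ → ℝ} (hφ : GrowthAssumptions φ) {a : ℝ} (ha : 0 < a)
    {Ω : Set (Space n)} (hΩ_open : IsOpen Ω) (hΩ_conn : IsConnected Ω)
    (hΩ_bdd : Bornology.IsBounded Ω)
    {f₀ : Space n → Space n} (hf₀ : IsEmbedding ((closure Ω).domRestrict f₀))
    (hf₀_sob : MemSobolev Ω p f₀) (hf₀_lusin : LusinN Ω f₀)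
    (hf₀_energy : energy Ω p φ f₀ < ⊤) (hf₀_bdry : volume (f₀ '' frontier Ω) = 0) (C : ℝ) :
    (∀ (f : Space n → Space n) (fk : ℕ → Space n → Space n) (Ak : ℕ → Set (Space n)),
      IsApproximation Ω p φ a f₀ C fk Ak f →
      (∀ᵐ x ∂(volume.restrict Ω), Tendsto (fun k => fk k x) atTop (𝓝 (f x))) →
      ∀ σ τ : ℕ → ℕ, StrictMono σ → StrictMono τ →
      ∀ A₁ A₂ : Set (Space n), NullMeasurableSet A₁ volume → NullMeasurableSet A₂ volume →
        TendstoInMeas (fun l => Ak (σ l)) A₁ → TendstoInMeas (fun m => Ak (τ m)) A₂ →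
        volume (A₁ ∆ A₂) = 0) ∧
    (∀ f ∈ weakClosure Ω p φ a f₀ C,
      (∃ A, IsLimitCavitySet Ω p φ a f₀ C f A) ∧
      ∀ A A', IsLimitCavitySet Ω p φ a f₀ C f A → IsLimitCavitySet Ω p φ a f₀ C f A' →
        volume (A ∆ A') = 0) := by
  have : Nontrivial (Fin n) := Fin.nontrivial_iff_two_le.2 hn
  have hbdd : Bornology.IsBounded (f₀ '' Ω) := isBounded_image_of_continuousOn_closure hΩ_bdd
    (continuousOn_iff_continuous_domRestrict.2 hf₀.continuous)
  obtain ⟨huniq, hlimit⟩ := theorem4p2_general (one_lt_of_natCast_div_two_lt hn hp)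
    hφ.tendsto_zero hφ.tendsto_top ha hΩ_open hΩ_bdd.measure_lt_top.ne hbdd hf₀_bdry C
  exact ⟨fun f fk Ak h _ => huniq f fk Ak h, hlimit⟩
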